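/- **Setting.** Let $G=(V,E)$ be a finite directed acyclic graph with $V\neq\emptyset$ (parallel edges allowed); each edge $e$ goes from its tail to its head. A source (sink) is a vertex without incoming (outgoing) edges; the other vertices, which are neither sources nor sinks, are internal. Let $\mathbf a\in\mathbb Z^V$ be *conservationist*: $\mathbf a_i=1$ at every source, $\mathbf a_i<0$ at every sink, $\mathbf a_i=0$ at every internal vertex. The flow polytope $\mathcal F_G(\mathbf a)$ is the set of $F:E\to\mathbb R_{\ge 0}$ such that for every vertex $i$ the sum of $F$ over edges leaving $i$ minus the sum over edges entering $i$ equals $\mathbf a_i$ (such $F$ are the $\mathbf a$-flows). A *framing* $\mathfrak F$ consists of a total order on the outgoing edges of each non-sink vertex, a total order on the incoming edges of each internal vertex, and a total order on the sources. **Routes.** A route is a directed path from a source to a sink; its indicator vector $I(p)\in\mathbb R^E$ is $1$ on the edges of $p$ and $0$ elsewhere. Two distinct paths from a vertex $i$ to sinks are compared by $<_i^+$ according to the framing order of the first edges in which they differ; two distinct paths from sources to a non-sink vertex $i$ are compared by $<_i^-$ according to the framing order of the last edges in which they differ. Two routes $p,q$ are *incompatible* if they share a vertex $i$ at which, up to exchanging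 $p$ and $q$, the part of $p$ before $i$ is $<_i^-$ that of $q$ while the part of $q$ after $i$ is $<_i^+$ that of $p$. A *route-clique* is a set of pairwise compatible routes. **Layerings.** A *layering* is a set $L$ of routes with exactly one route starting at each source and exactly $|\mathbf a_j|$ routes ending at each sink $j$; put $J(L)=\sum_{p\in L}I(p)$. For distinct layerings $L,M$ let $s$ be the largest source, in the framing order, at which the routes of $L$ and $M$ starting there differ; write $L<M$ if the route of $L$ from $s$ is $<_s^+$ that of $M$. For a set $\mathcal K$ of layerings let $\mathrm{routes}(\mathcal K)$ be the set of all routes occurring in its members. A finite set $\mathcal L=\{L^1<\dots<L^m\}$ of layerings ($m\ge 0$) is a *layering-simplex* if 1. $\mathrm{routes}(\mathcal L)$ is a route-clique; 2. for every $i$, $L^i$ is the $<$-minimum of all layerings $L$ with $L\subseteq \mathrm{routes}(\{L^i,\dots,L^m\})$; 3. for every $i$, some route of $L^i$ is not in $\mathrm{routes}(\{L^{i+1},\dots,L^m\})$. Its polyhedral layering-simplex $\Delta_1(\mathcal L)$ is the set of all $\mathbf a$-flows of the form $\sum_{L\in\mathcal L}c_LJ(L)$ with all $c_L\ge 0$.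 **Triangulations.** An integer polytope in $\mathbb R^E$ is the convex hull of a finite set of points of $\mathbb Z^E$; it is an integer simplex if these points can be taken affinely independent ($\emptyset$ is allowed). A lattice triangulation of an integer polytope $P$ is a finite set $\mathcal T$ of integer simplices with union $P$ that contains every face (including $\emptyset$) of each of its members and such that the intersection of any two members is a (possibly empty) face of both. It is unimodular if each nonempty member has normalized volume $1$ within its affine span, where the normalized volume of a $d$-dimensional simplex is $d!$ times its volume measured so that the lattice of integer points of the direction space of its affine span has covolume $1$. **Statement.** The polytope $\mathcal F_G(\mathbf a)$ is an integer polytope, and $$\mathcal T(G,\mathbf a,\mathfrak F)=\{\Delta_1(\mathcal L):\mathcal L\text{ is a layering-simplex}\}$$ is a unimodular lattice triangulation of it. Moreover, for every layering-simplex $\mathcal L$ the vectors $J(L)$, $L\in\mathcal L$, are affinely independent and $\Delta_1(\mathcal L)$ is their convex hull (so $\Delta_1(\mathcal L)$ is a simplex), and for all layering-simplices $\mathcal K,\mathcal L$ one has $\Delta_1(\mathcal K)\cap\Delta_1(\mathcal L)=\Delta_1(\mathcal K\cap\mathcal L)$. -/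

import Mathlib

noncomputable section

/-! ### Lattice polytopes and triangulations in `ℝ^E` -/

/-- A point of `ℝ^E` all of whose coordinates are integers. -/
def IsIntegerPoint {E : Type*} (x : E → ℝ) : Prop :=
  ∀ e, ∃ n : ℤ, x e = n

/-- An integer polytope: the convex hull of finitely many integer points (possibly empty). -/
def IsIntegerPolytope {E : Type*} (P : Set (E → ℝ)) : Prop :=
  ∃ s : Finset (E → ℝ), (∀ v ∈ s, IsIntegerPoint v) ∧ P = convexHull ℝ (s : Set (E → ℝ))

/-- An integer simplex: the convex hull of finitely many affinely independent integer points.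
The empty set counts as the simplex without vertices. -/
def IsIntegerSimplex {E : Type*} (S : Set (E → ℝ)) : Prop :=
  ∃ s : Finset (E → ℝ), (∀ v ∈ s, IsIntegerPoint v) ∧
    AffineIndependent ℝ (fun v : s => (v : E → ℝ)) ∧ S = convexHull ℝ (s : Set (E → ℝ))

/-- The lattice `D ∩ ℤ^E` of integer points of a linear subspace `D` of `ℝ^E`. -/
def integerPointsIn {E : Type*} (D : Submodule ℝ (E → ℝ)) : Submodule ℤ D where
  carrier := {w | IsIntegerPoint (w : E → ℝ)}
  zero_mem' := fun e => ⟨0, by simp⟩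
  add_mem' := by
    intro x y hx hy e
    obtain ⟨m, hm⟩ := hx e
    obtain ⟨n, hn⟩ := hy e
    exact ⟨m + n, by simp [hm, hn]⟩
  smul_mem' := by
    intro c x hx e
    obtain ⟨m, hm⟩ := hx e
    exact ⟨c * m, by simp [hm]⟩

/-- The volume of a subset `A` of a linear subspace `D` of `ℝ^E`, in the unit in which the lattice
`D ∩ ℤ^E` has covolume `1`. It does not depend on the choice of the Haar measure on `D`. -/
def latticeVolume {E : Type*} [Fintype E] (D : Submodule ℝ (E → ℝ)) (A : Set D) : ℝ :=
  (MeasureTheory.Measure.addHaar : MeasureTheory.Measure D).real A /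
    ZLattice.covolume (integerPointsIn D) MeasureTheory.Measure.addHaar

/-- The normalized volume of `P` within its affine span: if `d` is the dimension of `P`, it is `d!`
times the volume of `P`, translated by one of its points into the direction of its affine span
(the choice of the point does not matter). It is `0` for `P = ∅`. -/
def normalizedVolume {E : Type*} [Fintype E] (P : Set (E → ℝ)) : ℝ :=
  open Classical in
  if h : P.Nonempty then
    (Nat.factorial (Module.finrank ℝ (vectorSpan ℝ P)) : ℝ) *
      latticeVolume (vectorSpan ℝ P) {w | h.some + (w : E → ℝ) ∈ P}
  else 0

/-- A lattice triangulation of a polytope `P`. The faces of a simplex are its exposed faces, that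
is, the empty set and the sets of maximizers of linear functionals (the simplex itself included). -/
structure IsLatticeTriangulation {E : Type*} (P : Set (E → ℝ)) (T : Set (Set (E → ℝ))) :
    Prop where
  isIntegerPolytope : IsIntegerPolytope P
  finite : T.Finite
  isIntegerSimplex : ∀ S ∈ T, IsIntegerSimplex S
  cover : P = ⋃₀ T
  face_mem : ∀ S ∈ T, ∀ S', IsExposed ℝ S S' → S' ∈ T
  inter_face : ∀ S₁ ∈ T, ∀ S₂ ∈ T, IsExposed ℝ S₁ (S₁ ∩ S₂) ∧ IsExposed ℝ S₂ (S₁ ∩ S₂)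

/-- A triangulation is unimodular if each of its (nonempty) simplices has normalized volume `1`
within its affine span. -/
def IsUnimodularLatticeTriangulation {E : Type*} [Fintype E] (P : Set (E → ℝ))
    (T : Set (Set (E → ℝ))) : Prop :=
  IsLatticeTriangulation P T ∧ ∀ S ∈ T, S.Nonempty → normalizedVolume S = 1

/-! ### Directed graphs, netflow vectors and flow polytopes -/

/-- A directed graph with vertex set `V` and edge set `E`; parallel edges are allowed. -/
structure DirectedMultigraph (V E : Type*) where
  tail : E → V
  head : E → V

namespace DirectedMultigraph

variable {V E : Type*}

/-- There is no oriented cycle. -/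
def IsAcyclic (G : DirectedMultigraph V E) : Prop :=
  ∀ v, ¬ Relation.TransGen (fun u w => ∃ e, G.tail e = u ∧ G.head e = w) v v

def IsSource (G : DirectedMultigraph V E) (v : V) : Prop := ∀ e, G.head e ≠ v

def IsSink (G : DirectedMultigraph V E) (v : V) : Prop := ∀ e, G.tail e ≠ v

/-- A vertex that is neither a source nor a sink. -/
def IsInternal (G : DirectedMultigraph V E) (v : V) : Prop := ¬ G.IsSource v ∧ ¬ G.IsSink v

/-- The set of nonnegative `a`-flows of `G`. -/
def flowPolytope [Fintype E] (G : DirectedMultigraph V E) (a : V → ℤ) : Set (E → ℝ) :=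
  open Classical in
  {F | (∀ e, 0 ≤ F e) ∧
    ∀ v, (∑ e with G.tail e = v, F e) - (∑ e with G.head e = v, F e) = (a v : ℝ)}

structure IsConservationist (G : DirectedMultigraph V E) (a : V → ℤ) : Prop where
  source : ∀ v, G.IsSource v → a v = 1
  sink : ∀ v, G.IsSink v → a v < 0
  internal : ∀ v, G.IsInternal v → a v = 0

/-- A framing: total orders on the outgoing edges of each non-sink vertex, on the incoming edges
of each internal vertex, and on the source vertices. -/
structure Framing (G : DirectedMultigraph V E) where
  outOrder : ∀ v, ¬ G.IsSink v → LinearOrder {e : E // G.tail e = v}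
  inOrder : ∀ v, G.IsInternal v → LinearOrder {e : E // G.head e = v}
  srcOrder : LinearOrder {v : V // G.IsSource v}

/-! ### Routes and their compatibility -/

/-- `G.IsPath u l v` says that the list of edges `l` is a directed path from `u` to `v`. -/
def IsPath (G : DirectedMultigraph V E) : V → List E → V → Prop
  | u, [], v => u = v
  | u, e :: l, v => G.tail e = u ∧ G.IsPath (G.head e) l v

/-- A route: a path from a source to a sink. -/
@[ext]
structure Route (G : DirectedMultigraph V E) where
  start : V
  edges : List E
  finish : V
  isSource : G.IsSource start
  isSink : G.IsSink finish
  isPath : G.IsPath start edges finish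

/-- The indicator vector of a route in `ℝ^E`. -/
def Route.indicator {G : DirectedMultigraph V E} (p : G.Route) : E → ℝ :=
  open Classical in
  fun e => if e ∈ p.edges then 1 else 0

variable {G : DirectedMultigraph V E}

/-- `e` and `f` leave the same vertex and `e` is smaller in the framing order there. -/
def Framing.OutLT (Φ : G.Framing) (e f : E) : Prop :=
  ∃ (v : V) (hv : ¬ G.IsSink v) (he : G.tail e = v) (hf : G.tail f = v),
    (Φ.outOrder v hv).lt ⟨e, he⟩ ⟨f, hf⟩

/-- `e` and `f` enter the same internal vertex and `e` is smaller in the framing order there. -/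
def Framing.InLT (Φ : G.Framing) (e f : E) : Prop :=
  ∃ (v : V) (hv : G.IsInternal v) (he : G.head e = v) (hf : G.head f = v),
    (Φ.inOrder v hv).lt ⟨e, he⟩ ⟨f, hf⟩

/-- The post-order on paths (edge lists) from a common vertex to sinks: `p` and `q` are compared
by the first edges in which they differ. -/
def Framing.PostLT (Φ : G.Framing) (p q : List E) : Prop :=
  ∃ (σ p' q' : List E) (f g : E), p = σ ++ f :: p' ∧ q = σ ++ g :: q' ∧ Φ.OutLT f g

/-- The pre-order on paths (edge lists) from sources to a common vertex: `p` and `q` are compared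
by the last edges in which they differ. -/
def Framing.PreLT (Φ : G.Framing) (p q : List E) : Prop :=
  ∃ (σ p' q' : List E) (f g : E), p = p' ++ f :: σ ∧ q = q' ++ g :: σ ∧ Φ.InLT f g

/-- The route `p` passes through the vertex `i`, with part `p₁` before `i` and part `p₂` after. -/
def Route.SplitsAt (p : G.Route) (i : V) (p₁ p₂ : List E) : Prop :=
  p.edges = p₁ ++ p₂ ∧ G.IsPath p.start p₁ i ∧ G.IsPath i p₂ p.finish

/-- `p` and `q` share the vertex `i` and are ordered oppositely before and after `i`. -/
def Framing.IncompatibleAt (Φ : G.Framing) (p q : G.Route) (i : V) : Prop :=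
  ∃ p₁ p₂ q₁ q₂ : List E, p.SplitsAt i p₁ p₂ ∧ q.SplitsAt i q₁ q₂ ∧
    ((Φ.PreLT p₁ q₁ ∧ Φ.PostLT q₂ p₂) ∨ (Φ.PreLT q₁ p₁ ∧ Φ.PostLT p₂ q₂))

/-- A set of pairwise compatible routes. -/
def Framing.IsRouteClique (Φ : G.Framing) (R : Set G.Route) : Prop :=
  ∀ p ∈ R, ∀ q ∈ R, ∀ i, ¬ Φ.IncompatibleAt p q i

/-! ### Layerings -/

/-- A layering: a set of routes, exactly one of which starts at each source and exactly `|a j|` of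
which end at each sink `j`. -/
@[ext]
structure Layering (G : DirectedMultigraph V E) (a : V → ℤ) where
  routes : Finset G.Route
  existsUnique_start : ∀ s, G.IsSource s → ∃! p, p ∈ routes ∧ p.start = s
  card_finish : ∀ j, G.IsSink j → (({p ∈ (routes : Set G.Route) | p.finish = j}.ncard : ℕ) : ℤ) = |a j|

variable {a : V → ℤ}

instance : DecidableEq (G.Layering a) := Classical.decEq _

/-- The route of a layering that starts at the source `s`. -/
def Layering.routeFrom (L : G.Layering a) (s : {v : V // G.IsSource v}) : G.Route :=
  (L.existsUnique_start s s.2).choose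

/-- The indicator vector of a layering: the sum of the indicator vectors of its routes. -/
def Layering.indicator (L : G.Layering a) : E → ℝ := ∑ p ∈ L.routes, p.indicator

/-- The post-source order: compare the routes from the largest source at which they differ. -/
def Framing.LayeringLT (Φ : G.Framing) (L M : G.Layering a) : Prop :=
  ∃ s : {v : V // G.IsSource v}, Φ.PostLT (L.routeFrom s).edges (M.routeFrom s).edges ∧
    ∀ t, Φ.srcOrder.lt s t → L.routeFrom t = M.routeFrom t

/-- The set of all routes used by a set of layerings. -/
def routesOf (K : Set (G.Layering a)) : Set G.Route := {p | ∃ L ∈ K, p ∈ L.routes}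

/-- A finite set `K` of layerings is a layering-simplex if its routes are a route-clique and each
`L ∈ K` is the smallest of all layerings that use only routes of the members of `K` that are at
least `L`, and has a route that is in no member of `K` larger than `L`. -/
structure Framing.IsLayeringSimplex (Φ : G.Framing) (K : Finset (G.Layering a)) : Prop where
  clique : Φ.IsRouteClique (routesOf (K : Set (G.Layering a)))
  minimal : ∀ L ∈ K, ∀ M : G.Layering a,
    (∀ p ∈ M.routes, p ∈ routesOf {N | N ∈ K ∧ (L = N ∨ Φ.LayeringLT L N)}) →
      L = M ∨ Φ.LayeringLT L M
  new_route : ∀ L ∈ K, ∃ p ∈ L.routes, p ∉ routesOf {N | N ∈ K ∧ Φ.LayeringLT L N}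

/-- The polyhedral layering-simplex: the `a`-flows that are nonnegative combinations of the
indicator vectors of the layerings in `K`. -/
def polyhedralSimplex [Fintype E] (K : Finset (G.Layering a)) : Set (E → ℝ) :=
  {F | F ∈ G.flowPolytope a ∧
    ∃ c : G.Layering a → ℝ, (∀ L ∈ K, 0 ≤ c L) ∧ F = ∑ L ∈ K, c L • L.indicator}

/-- The set of the polyhedral layering-simplices of all layering-simplices. -/
def framingTriangulation [Fintype E] (a : V → ℤ) (Φ : G.Framing) : Set (Set (E → ℝ)) :=
  {S | ∃ K : Finset (G.Layering a), Φ.IsLayeringSimplex K ∧ S = polyhedralSimplex K}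

end DirectedMultigraph

end

/-! Every flow is a nonnegative combination of the indicator vectors of the routes of a clique:
among all such combinations one maximizes a weight that strictly increases whenever two incompatible
routes are uncrossed. The decomposition is unique, and integral for an integral flow: the routes of
a clique pass every edge in a linear order, so the flow through the edge can be laid out on an
interval, and the conservation of flow at a vertex matches the intervals of the incoming edges with
those of the outgoing edges piece by piece, by integer translations.

For an `a`-flow, the route coefficients are balanced: at every source they add up to a common total
`t`, and at every sink `j` to `|a j| t`. By Hall's theorem the support of such a vector contains a
layering. Repeatedly subtracting as much as possible of the minimal one writes the vector as a
nonnegative combination of the layerings of a layering-simplex; each of these has a route that does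
not occur in the later ones, and this triangularity makes the coefficients unique, and integers if
the route coefficients are.
-/

noncomputable section

open scoped Classical Finset

/-! ### Faces of convex hulls -/

section Faces

variable {W : Type*} [AddCommGroup W] [Module ℝ W]

theorem sep_convexHull_eq_convexHull_sep {s : Set W} {l : W →ₗ[ℝ] ℝ} {m : ℝ}
    (h : ∀ x ∈ s, l x ≤ m) :
    {x ∈ convexHull ℝ s | l x = m} = convexHull ℝ {x ∈ s | l x = m} := by
  refine subset_antisymm ?_ (convexHull_min (fun x hx => ⟨subset_convexHull ℝ s hx.1, hx.2⟩)
    ((convex_convexHull ℝ s).inter (convex_hyperplane l.isLinear m)))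
  suffices hs : convexHull ℝ s ⊆
      {x | l x ≤ m ∧ (l x = m → x ∈ convexHull ℝ {x ∈ s | l x = m})} from
    fun x hx => (hs hx.1).2 hx.2
  refine convexHull_min (fun x hx => ⟨h x hx, fun hxm => subset_convexHull ℝ _ ⟨hx, hxm⟩⟩) ?_
  refine convex_iff_forall_pos.2 fun x hx y hy α β hα hβ hαβ => ?_
  have hm : α * m + β * m = m := by rw [← add_mul, hαβ, one_mul]
  have hxm := mul_le_mul_of_nonneg_left hx.1 hα.le
  have hym := mul_le_mul_of_nonneg_left hy.1 hβ.le
  simp only [Set.mem_ofPred_eq, map_add, map_smul, smul_eq_mul]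
  refine ⟨by linarith, fun heq => convex_convexHull ℝ _ (hx.2 ?_) (hy.2 ?_) hα.le hβ.le hαβ⟩
  · exact mul_left_cancel₀ hα.ne' (by linarith)
  · exact mul_left_cancel₀ hβ.ne' (by linarith)

variable [TopologicalSpace W]

theorem exists_subset_eq_convexHull_of_isExposed {s B : Set W}
    (hB : IsExposed ℝ (convexHull ℝ s) B) : ∃ t ⊆ s, B = convexHull ℝ t := by
  rcases B.eq_empty_or_nonempty with rfl | hne
  · exact ⟨∅, Set.empty_subset s, convexHull_empty.symm⟩
  obtain ⟨l, rfl⟩ := hB hne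
  obtain ⟨x₀, hx₀, hmax⟩ := hne
  refine ⟨{x ∈ s | l x = l x₀}, Set.sep_subset _ _, ?_⟩
  refine Eq.trans ?_ (sep_convexHull_eq_convexHull_sep (l := l.toLinearMap)
    fun x hx => hmax x (subset_convexHull ℝ s hx))
  ext x
  exact ⟨fun hx => ⟨hx.1, (hmax x hx.1).antisymm (hx.2 x₀ hx₀)⟩,
    fun hx => ⟨hx.1, fun y hy => (hmax y hy).trans_eq hx.2.symm⟩⟩

theorem isExposed_convexHull_of_linearIndepOn [IsTopologicalAddGroup W] [ContinuousSMul ℝ W]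
    [T2Space W] [FiniteDimensional ℝ W] {s t : Set W} (hs : LinearIndepOn ℝ id s) (hts : t ⊆ s) :
    IsExposed ℝ (convexHull ℝ s) (convexHull ℝ t) := by
  intro hne
  obtain ⟨x₀, hx₀⟩ := convexHull_nonempty_iff.1 hne
  let b := Module.Basis.extend hs
  -- The functional equal to `1` on `t` and to `0` on the rest of `s` exposes the hull of `t`.
  let l : W →ₗ[ℝ] ℝ := b.constr ℝ fun x => if (x : W) ∈ t then 1 else 0
  have hl : ∀ x ∈ s, l x = if x ∈ t then 1 else 0 := fun x hx => by
    have := b.constr_basis ℝ (fun x => if (x : W) ∈ t then (1 : ℝ) else 0)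
      ⟨x, hs.subset_extend _ hx⟩
    rwa [Module.Basis.extend_apply_self] at this
  have hle : ∀ x ∈ s, l x ≤ 1 := fun x hx => by rw [hl x hx]; split_ifs <;> norm_num
  have hle' : convexHull ℝ s ⊆ {x | l x ≤ 1} :=
    convexHull_min hle (convex_halfSpace_le l.isLinear 1)
  have hst : t = {x ∈ s | l x = 1} := by
    ext x
    refine ⟨fun hx => ⟨hts hx, by rw [hl x (hts hx), if_pos hx]⟩, fun hx => ?_⟩
    by_contra hxt
    exact zero_ne_one ((if_neg hxt).symm.trans ((hl x hx.1).symm.trans hx.2))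
  have hlx₀ : l x₀ = 1 := by rw [hl x₀ (hts hx₀), if_pos hx₀]
  refine ⟨LinearMap.toContinuousLinearMap l, ?_⟩
  rw [hst, ← sep_convexHull_eq_convexHull_sep hle]
  ext x
  exact ⟨fun hx => ⟨hx.1, fun y hy => (hle' hy).trans_eq hx.2.symm⟩,
    fun hx => ⟨hx.1, (hle' hx.1).antisymm
      (hlx₀.symm.trans_le (hx.2 x₀ (subset_convexHull ℝ s (hts hx₀))))⟩⟩

end Faces

/-! ### The normalized volume of a unimodular simplex -/

section Volume

open MeasureTheory

/-- The simplex in `ℝ^κ` with vertices `0` and `t e_k`, the model whose volume is computed. -/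
def cornerSimplex (κ : Type*) [Fintype κ] (t : ℝ) : Set (κ → ℝ) := {x | 0 ≤ x ∧ ∑ k, x k ≤ t}

theorem measurableSet_cornerSimplex (κ : Type*) [Fintype κ] (t : ℝ) :
    MeasurableSet (cornerSimplex κ t) :=
  (isClosed_Ici.inter (isClosed_le (f := fun x : κ → ℝ => ∑ k, x k) (by fun_prop)
    continuous_const)).measurableSet

theorem cons_mem_cornerSimplex_iff {n : ℕ} {t x : ℝ} {y : Fin n → ℝ} :
    (Fin.cons x y : Fin (n + 1) → ℝ) ∈ cornerSimplex (Fin (n + 1)) t ↔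
      0 ≤ x ∧ y ∈ cornerSimplex (Fin n) (t - x) := by
  simp [cornerSimplex, Pi.le_def, Fin.forall_fin_succ, Fin.sum_univ_succ, and_assoc,
    le_sub_iff_add_le, add_comm]

theorem cornerSimplex_eq_empty {κ : Type*} [Fintype κ] {t : ℝ} (ht : t < 0) :
    cornerSimplex κ t = ∅ :=
  Set.eq_empty_of_forall_notMem fun _ hx =>
    ht.not_ge ((Finset.sum_nonneg fun k _ => hx.1 k).trans hx.2)

theorem lintegral_sub_pow_div_factorial (n : ℕ) {t : ℝ} (ht : 0 ≤ t) :
    ∫⁻ x in Set.Icc 0 t, ENNReal.ofReal ((t - x) ^ n / n.factorial) =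
      ENNReal.ofReal (t ^ (n + 1) / (n + 1).factorial) := by
  rw [← ofReal_integral_eq_lintegral_ofReal]
  · rw [integral_Icc_eq_integral_Ioc, ← intervalIntegral.integral_of_le ht,
      intervalIntegral.integral_div, intervalIntegral.integral_comp_sub_left (fun x => x ^ n),
      integral_pow, sub_self, sub_zero, Nat.factorial_succ, zero_pow n.succ_ne_zero, sub_zero,
      div_div]
    push_cast
    rfl
  · exact (Continuous.continuousOn (by fun_prop)).integrableOn_Icc
  · refine (ae_restrict_iff' measurableSet_Icc).2 (Filter.Eventually.of_forall fun x hx => ?_)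
    exact div_nonneg (pow_nonneg (sub_nonneg.2 hx.2) n) (Nat.cast_nonneg _)

theorem volume_cornerSimplex_fin (n : ℕ) {t : ℝ} (ht : 0 ≤ t) :
    volume (cornerSimplex (Fin n) t) = ENNReal.ofReal (t ^ n / n.factorial) := by
  induction n generalizing t with
  | zero =>
    have huniv : cornerSimplex (Fin 0) t = Set.univ :=
      Set.eq_univ_of_forall fun x => ⟨fun i => i.elim0, by simpa using ht⟩
    rw [huniv, volume_pi, Measure.pi_univ]
    simp
  | succ n ih =>
    have hmp := (volume_preserving_piFinSuccAbove (fun _ : Fin (n + 1) => ℝ) 0).symm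
    have hmeas := measurableSet_cornerSimplex (Fin (n + 1)) t
    rw [← hmp.measure_preimage hmeas.nullMeasurableSet, Measure.volume_eq_prod,
      Measure.prod_apply (hmeas.preimage hmp.measurable), ← lintegral_sub_pow_div_factorial n ht,
      ← lintegral_indicator measurableSet_Icc]
    refine lintegral_congr fun x => ?_
    have hslice : Prod.mk x ⁻¹' ((MeasurableEquiv.piFinSuccAbove (fun _ : Fin (n + 1) => ℝ)
        0).symm ⁻¹' cornerSimplex (Fin (n + 1)) t) =
          {y : Fin n → ℝ | 0 ≤ x ∧ y ∈ cornerSimplex (Fin n) (t - x)} := by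
      ext y
      rw [Set.mem_ofPred_eq, ← cons_mem_cornerSimplex_iff, ← Fin.insertNth_zero']
      rfl
    rw [hslice]
    by_cases hx : x ∈ Set.Icc 0 t
    · simp [Set.indicator_of_mem hx, hx.1, ← ih (sub_nonneg.2 hx.2)]
    · rw [Set.indicator_of_notMem hx, ← measure_empty (μ := volume (α := Fin n → ℝ))]
      congr 1
      by_cases hx0 : 0 ≤ x
      · simp [hx0, cornerSimplex_eq_empty (sub_neg.2 (lt_of_not_ge fun h => hx ⟨hx0, h⟩))]
      · simp [hx0]

theorem volume_cornerSimplex (κ : Type*) [Fintype κ] {t : ℝ} (ht : 0 ≤ t) :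
    volume (cornerSimplex κ t) =
      ENNReal.ofReal (t ^ Fintype.card κ / (Fintype.card κ).factorial) := by
  let e := (Fintype.equivFin κ).symm
  rw [← volume_cornerSimplex_fin _ ht,
    ← (volume_measurePreserving_piCongrLeft (fun _ : κ => ℝ) e).measure_preimage_equiv]
  congr 1
  ext x
  have hx : ∀ i, MeasurableEquiv.piCongrLeft (fun _ : κ => ℝ) e x (e i) = x i :=
    fun i => MeasurableEquiv.piCongrLeft_apply_apply (β := fun _ : κ => ℝ) e x i
  simp only [cornerSimplex, Set.mem_preimage, Set.mem_ofPred_eq, Pi.le_def, ← e.sum_comp,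
    ← e.forall_congr_right, hx, Pi.zero_apply]

theorem cornerSimplex_one_eq_convexHull (κ : Type*) [Fintype κ] :
    cornerSimplex κ 1 = convexHull ℝ (insert 0 (Set.range fun k => Pi.single k (1 : ℝ))) := by
  refine subset_antisymm (fun x hx => ?_) (convexHull_min ?_ ?_)
  · have hmem : ∀ o : Option κ, (o.elim 0 fun k => Pi.single k (1 : ℝ)) ∈
        convexHull ℝ (insert 0 (Set.range fun k => Pi.single k (1 : ℝ))) := by
      rintro (_ | k)
      · exact subset_convexHull ℝ _ (Set.mem_insert _ _)
      · exact subset_convexHull ℝ _ (Set.mem_insert_of_mem _ ⟨k, rfl⟩)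
    have hx0 : ∀ o : Option κ, 0 ≤ o.elim (1 - ∑ k, x k) x := by
      rintro (_ | k)
      · exact sub_nonneg.2 hx.2
      · exact hx.1 k
    have := (convex_convexHull ℝ _).sum_mem (t := Finset.univ) (fun o _ => hx0 o)
      (by simp [Fintype.sum_option]) fun o _ => hmem o
    rw [Fintype.sum_option] at this
    simpa [← pi_eq_sum_univ'] using this
  · rintro _ (rfl | ⟨k, rfl⟩)
    · exact ⟨le_rfl, by simp⟩
    · exact ⟨Pi.single_nonneg.2 zero_le_one, by simp⟩
  · exact (convex_Ici 0).inter (convex_halfSpace_le (f := fun x : κ → ℝ => ∑ k, x k)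
      ⟨fun x y => Finset.sum_add_distrib, fun c x => (Finset.mul_sum _ _ _).symm⟩ 1)

theorem add_sum_smul_mem_convexHull_iff {W κ : Type*} [AddCommGroup W] [Module ℝ W] [Fintype κ]
    {u : κ → W} (hu : LinearIndependent ℝ u) (p : W) (x : κ → ℝ) :
    p + ∑ k, x k • u k ∈ convexHull ℝ (insert p (Set.range fun k => p + u k)) ↔
      x ∈ cornerSimplex κ 1 := by
  let f : (κ → ℝ) →ᵃ[ℝ] W :=
    AffineMap.const ℝ (κ → ℝ) p + (Fintype.linearCombination ℝ u).toAffineMap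
  have hf : ∀ x, f x = p + ∑ k, x k • u k := fun x => by simp [f, Fintype.linearCombination_apply]
  have hinj : Function.Injective f := fun x y hxy =>
    hu.fintypeLinearCombination_injective (add_left_cancel hxy)
  have himage : insert p (Set.range fun k => p + u k) =
      f '' insert 0 (Set.range fun k => Pi.single k (1 : ℝ)) := by
    rw [Set.image_insert_eq, ← Set.range_comp]
    simp [hf, Function.comp_def, Pi.single_apply]
  rw [← hf, himage, ← f.image_convexHull, hinj.mem_set_image, cornerSimplex_one_eq_convexHull]

theorem measureReal_preimage_equivFun_div_covolume {D κ : Type*} [NormedAddCommGroup D]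
    [NormedSpace ℝ D] [MeasurableSpace D] [BorelSpace D] [FiniteDimensional ℝ D] [Fintype κ]
    (μ : Measure D) [μ.IsAddHaarMeasure] (b : Module.Basis κ ℝ D) (B : Set (κ → ℝ)) :
    μ.real (b.equivFun ⁻¹' B) / ZLattice.covolume (Submodule.span ℤ (Set.range b)) μ =
      volume.real B := by
  have := b.equivFunL.isAddHaarMeasure_map μ
  set ν : Measure (κ → ℝ) := μ.map b.equivFunL
  obtain ⟨r, hr0, hr⟩ : ∃ r : NNReal, r ≠ 0 ∧ ν = r • volume :=
    ⟨_, (Measure.addHaarScalarFactor_pos_of_isAddHaarMeasure ν volume).ne',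
      Measure.isAddLeftInvariant_eq_smul ν volume⟩
  have hpreimage : ∀ B : Set (κ → ℝ), μ.real (b.equivFun ⁻¹' B) = r * volume.real B := fun B => by
    have hmap : ν B = μ (b.equivFun ⁻¹' B) := b.equivFunL.toHomeomorph.toMeasurableEquiv.map_apply B
    simp [measureReal_def, ← hmap, hr]
  have hdomain : ZSpan.fundamentalDomain b =
      b.equivFun ⁻¹' Set.pi Set.univ fun _ => Set.Ico 0 1 := by
    ext w
    simp [ZSpan.mem_fundamentalDomain]
  have hcube : volume.real (Set.pi Set.univ fun _ : κ => Set.Ico (0 : ℝ) 1) = 1 := by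
    simp [measureReal_def, Real.volume_pi_Ico]
  rw [ZLattice.covolume_eq_measure_fundamentalDomain _ μ (ZSpan.isAddFundamentalDomain b μ),
    hdomain, hpreimage, hpreimage, hcube, mul_one, mul_div_cancel_left₀]
  exact_mod_cast hr0

theorem normalizedVolume_eq_of_mem {E : Type*} [Fintype E] {P : Set (E → ℝ)} {p : E → ℝ}
    (hp : p ∈ P) : normalizedVolume P = (Module.finrank ℝ (vectorSpan ℝ P)).factorial *
      latticeVolume (vectorSpan ℝ P) {w | p + (w : E → ℝ) ∈ P} := by
  have hne : P.Nonempty := ⟨p, hp⟩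
  let δ : vectorSpan ℝ P := ⟨hne.some - p, vsub_mem_vectorSpan ℝ hne.some_mem hp⟩
  have htranslate : {w : vectorSpan ℝ P | hne.some + (w : E → ℝ) ∈ P} =
      (fun w => δ + w) ⁻¹' {w : vectorSpan ℝ P | p + (w : E → ℝ) ∈ P} := by
    ext w
    simp only [δ, Set.mem_preimage, Set.mem_ofPred_eq, Submodule.coe_add]
    rw [← add_assoc, add_sub_cancel]
  rw [normalizedVolume, dif_pos hne, htranslate, latticeVolume, measureReal_def,
    measure_preimage_add, ← measureReal_def, latticeVolume]

theorem vectorSpan_convexHull_insert_range {W κ : Type*} [AddCommGroup W] [Module ℝ W]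
    (p : W) (u : κ → W) :
    vectorSpan ℝ (convexHull ℝ (insert p (Set.range fun k => p + u k))) =
      Submodule.span ℝ (Set.range u) := by
  rw [← direction_affineSpan, affineSpan_convexHull, direction_affineSpan,
    vectorSpan_eq_span_vsub_set_right ℝ (Set.mem_insert _ _), Set.image_insert_eq,
    ← Set.range_comp]
  simp [Function.comp_def]

theorem integerPointsIn_eq_span {E κ : Type*} [Fintype κ] {D : Submodule ℝ (E → ℝ)}
    {b : Module.Basis κ ℝ D} (hb : ∀ k, IsIntegerPoint (b k : E → ℝ))
    (hcoeff : ∀ r : κ → ℝ, IsIntegerPoint (∑ k, r k • (b k : E → ℝ)) → IsIntegerPoint r) :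
    integerPointsIn D = Submodule.span ℤ (Set.range b) := by
  refine le_antisymm (fun w hw => ?_) (Submodule.span_le.2 (Set.range_subset_iff.2 hb))
  have hsum : ∑ k, b.repr w k • (b k : E → ℝ) = w := by
    exact_mod_cast congrArg Subtype.val (b.sum_repr w)
  refine (b.mem_span_iff_repr_mem ℤ w).2 fun k => ?_
  obtain ⟨n, hn⟩ := hcoeff (b.repr w) (by rwa [hsum]) k
  exact ⟨n, by simp [hn]⟩

theorem normalizedVolume_convexHull_insert_range {E κ : Type*} [Fintype E] [Fintype κ]
    {u : κ → E → ℝ} (hu : LinearIndependent ℝ u) (hint : ∀ k, IsIntegerPoint (u k))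
    (hcoeff : ∀ r : κ → ℝ, IsIntegerPoint (∑ k, r k • u k) → IsIntegerPoint r) (p : E → ℝ) :
    normalizedVolume (convexHull ℝ (insert p (Set.range fun k => p + u k))) = 1 := by
  set S := convexHull ℝ (insert p (Set.range fun k => p + u k)) with hS
  obtain ⟨b, hb⟩ : ∃ b : Module.Basis κ ℝ (vectorSpan ℝ S), ∀ k, (b k : E → ℝ) = u k := by
    rw [hS, vectorSpan_convexHull_insert_range]
    exact ⟨Module.Basis.span hu, fun k => congrArg Subtype.val (Module.Basis.span_apply hu k)⟩
  have hcoord : {w : vectorSpan ℝ S | p + (w : E → ℝ) ∈ S} = b.equivFun ⁻¹' cornerSimplex κ 1 := by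
    ext w
    have hw : ∑ k, b.equivFun w k • u k = w := by
      simp only [← hb]
      exact_mod_cast congrArg Subtype.val (b.sum_equivFun w)
    rw [Set.mem_preimage, ← add_sum_smul_mem_convexHull_iff hu p, hw]
    rfl
  have hlattice : integerPointsIn (vectorSpan ℝ S) = Submodule.span ℤ (Set.range b) :=
    integerPointsIn_eq_span (by simpa only [hb] using hint) (by simpa only [hb] using hcoeff)
  rw [normalizedVolume_eq_of_mem (subset_convexHull ℝ _ (Set.mem_insert _ _)), latticeVolume,
    hcoord, hlattice, measureReal_preimage_equivFun_div_covolume, measureReal_def,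
    volume_cornerSimplex κ zero_le_one, Module.finrank_eq_card_basis b, one_pow,
    ENNReal.toReal_ofReal (by positivity), mul_one_div_cancel (by positivity)]

theorem exists_sum_smul_eq_sum_smul_sub {W ι : Type*} [AddCommGroup W] [Module ℝ W] (v : ι → W)
    {K : Finset ι} {i₀ : ι} (hi₀ : i₀ ∈ K) (r : K.erase i₀ → ℝ) :
    ∃ y : ι → ℝ, (∀ k : K.erase i₀, y k = r k) ∧ ∑ i ∈ K, y i • v i = ∑ k, r k • (v k - v i₀) := by
  let y (i : ι) : ℝ := if h : i ∈ K.erase i₀ then r ⟨i, h⟩ else -∑ k, r k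
  have hy (k : K.erase i₀) : y k = r k := dif_pos k.2
  refine ⟨y, hy, ?_⟩
  rw [← Finset.add_sum_erase K _ hi₀, ← Finset.sum_coe_sort (K.erase i₀),
    show y i₀ = -∑ k, r k from dif_neg (K.notMem_erase i₀)]
  simp only [hy, smul_sub, Finset.sum_sub_distrib, ← Finset.sum_smul, neg_smul]
  abel

theorem normalizedVolume_convexHull_image {E ι : Type*} [Fintype E] {v : ι → E → ℝ} {K : Finset ι}
    (hK : K.Nonempty) (hv : LinearIndepOn ℝ v K) (hint : ∀ i ∈ K, IsIntegerPoint (v i))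
    (hcoeff : ∀ y : ι → ℝ, IsIntegerPoint (∑ i ∈ K, y i • v i) → ∀ i ∈ K, ∃ n : ℤ, y i = n) :
    normalizedVolume (convexHull ℝ (v '' K)) = 1 := by
  obtain ⟨i₀, hi₀⟩ := hK
  have hmem (k : K.erase i₀) : k.1 ∈ K := Finset.mem_of_mem_erase k.2
  have himage : v '' K =
      insert (v i₀) (Set.range fun k : K.erase i₀ => v i₀ + (v k - v i₀)) := by
    simp_rw [add_sub_cancel]
    rw [← Finset.insert_erase hi₀, Finset.coe_insert, Set.image_insert_eq, Set.image_eq_range,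
      Finset.insert_erase hi₀]
    rfl
  rw [himage]
  refine normalizedVolume_convexHull_insert_range (Fintype.linearIndependent_iff.2 fun r hr k => ?_)
    (fun k e => ?_) (fun r hr k => ?_) _
  · obtain ⟨y, hyr, hy⟩ := exists_sum_smul_eq_sum_smul_sub v hi₀ r
    exact hyr k ▸ linearIndepOn_finset_iff.1 hv y (hy.trans hr) k (hmem k)
  · obtain ⟨m, hm⟩ := hint k (hmem k) e
    obtain ⟨n, hn⟩ := hint i₀ hi₀ e
    exact ⟨m - n, by simp [hm, hn]⟩
  · obtain ⟨y, hyr, hy⟩ := exists_sum_smul_eq_sum_smul_sub v hi₀ r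
    exact hyr k ▸ hcoeff y (hy ▸ hr) k (hmem k)

end Volume

namespace DirectedMultigraph

variable {V E : Type*} {G : DirectedMultigraph V E}

/-! ### Paths and routes -/

theorem isPath_append {u v : V} {l m : List E} :
    G.IsPath u (l ++ m) v ↔ ∃ w, G.IsPath u l w ∧ G.IsPath w m v := by
  induction l generalizing u with
  | nil => simp [IsPath]
  | cons e l ih => simp [IsPath, ih, and_assoc]

theorem isPath_append_cons {u v : V} {l m : List E} {e : E} :
    G.IsPath u (l ++ e :: m) v ↔ G.IsPath u l (G.tail e) ∧ G.IsPath (G.head e) m v := by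
  simp only [isPath_append, IsPath]
  exact ⟨fun ⟨_, h, rfl, h'⟩ => ⟨h, h'⟩, fun ⟨h, h'⟩ => ⟨_, h, rfl, h'⟩⟩

theorem isPath_concat {u v : V} {l : List E} {e : E} :
    G.IsPath u (l ++ [e]) v ↔ G.IsPath u l (G.tail e) ∧ G.head e = v :=
  isPath_append_cons

theorem not_isSink_tail (e : E) : ¬ G.IsSink (G.tail e) := fun h => h e rfl

theorem not_isSource_head (e : E) : ¬ G.IsSource (G.head e) := fun h => h e rfl

theorem IsPath.eq_nil_of_isSink {u v : V} {l : List E} (h : G.IsPath u l v) (hu : G.IsSink u) :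
    l = [] := by
  cases l with
  | nil => rfl
  | cons e l => exact absurd h.1 (hu e)

theorem IsPath.eq_nil_of_isSource {u v : V} {l : List E} (h : G.IsPath u l v)
    (hv : G.IsSource v) : l = [] := by
  rcases l.eq_nil_or_concat' with rfl | ⟨l, e, rfl⟩
  · rfl
  · exact absurd (isPath_concat.1 h).2 (hv e)

theorem IsPath.start_unique {u u' v v' : V} {l : List E} (h : G.IsPath u l v)
    (h' : G.IsPath u' l v') (hl : l ≠ []) : u = u' := by
  cases l with
  | nil => exact absurd rfl hl
  | cons e l => exact h.1.symm.trans h'.1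

theorem IsPath.finish_unique {u u' v v' : V} {l : List E} (h : G.IsPath u l v)
    (h' : G.IsPath u' l v') (hl : l ≠ []) : v = v' := by
  rcases l.eq_nil_or_concat' with rfl | ⟨l, e, rfl⟩
  · exact absurd rfl hl
  · exact (isPath_concat.1 h).2.symm.trans (isPath_concat.1 h').2

theorem IsPath.transGen {u v : V} {l : List E} (h : G.IsPath u l v) (hl : l ≠ []) :
    Relation.TransGen (fun u w => ∃ e, G.tail e = u ∧ G.head e = w) u v := by
  induction l generalizing u with
  | nil => exact absurd rfl hl
  | cons e l ih =>
    rcases l with _ | ⟨f, l⟩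
    · exact .single ⟨e, h⟩
    · exact .head ⟨e, h.1, rfl⟩ (ih h.2 (List.cons_ne_nil f l))

theorem IsPath.eq_nil (hG : G.IsAcyclic) {u : V} {l : List E} (h : G.IsPath u l u) : l = [] :=
  by_contra fun hl => hG u (h.transGen hl)

theorem IsPath.pairwise {u v : V} {l : List E} (h : G.IsPath u l v) :
    l.Pairwise fun e f => ∃ m, G.IsPath (G.head e) m (G.tail f) := by
  induction l generalizing u with
  | nil => exact List.Pairwise.nil
  | cons e l ih =>
    refine List.pairwise_cons.2 ⟨fun f hf => ?_, ih h.2⟩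
    obtain ⟨l₁, l₂, rfl⟩ := List.append_of_mem hf
    exact ⟨l₁, (isPath_append_cons.1 h.2).1⟩

theorem IsPath.nodup_map_tail (hG : G.IsAcyclic) {u v : V} {l : List E} (h : G.IsPath u l v) :
    (l.map G.tail).Nodup := by
  refine List.pairwise_map.2 (h.pairwise.imp ?_)
  rintro e f ⟨m, hm⟩ hef
  have hcycle : G.IsPath (G.tail e) (e :: m) (G.tail e) := ⟨rfl, hef ▸ hm⟩
  exact List.cons_ne_nil e m (hcycle.eq_nil hG)

theorem IsPath.nodup_map_head (hG : G.IsAcyclic) {u v : V} {l : List E} (h : G.IsPath u l v) :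
    (l.map G.head).Nodup := by
  refine List.pairwise_map.2 (h.pairwise.imp ?_)
  rintro e f ⟨m, hm⟩ hef
  have hcycle : G.IsPath (G.head e) (m ++ [f]) (G.head e) := isPath_concat.2 ⟨hm, hef.symm⟩
  simpa using hcycle.eq_nil hG

theorem IsPath.nodup (hG : G.IsAcyclic) {u v : V} {l : List E} (h : G.IsPath u l v) :
    l.Nodup :=
  (h.nodup_map_tail hG).of_map

theorem IsPath.monotone {α : Type*} [Preorder α] {t : V → α}
    (ht : ∀ e, t (G.tail e) ≤ t (G.head e)) {u v : V} {l : List E} (h : G.IsPath u l v) :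
    t u ≤ t v := by
  induction l generalizing u with
  | nil => exact (congrArg t (show u = v from h)).le
  | cons e l ih => exact h.1 ▸ (ht e).trans (ih h.2)

theorem IsPath.split_unique (hG : G.IsAcyclic) {u v i : V} {l₁ l₂ m₁ m₂ : List E}
    (hl₁ : G.IsPath u l₁ i) (hl₂ : G.IsPath i l₂ v) (hm₁ : G.IsPath u m₁ i)
    (hm₂ : G.IsPath i m₂ v) (h : l₁ ++ l₂ = m₁ ++ m₂) : l₁ = m₁ ∧ l₂ = m₂ := by
  have eq_nil_of_overlap {n n₁ n₂ : List E} (h₁ : G.IsPath u (n₁ ++ n) i)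
      (h₂ : G.IsPath i (n ++ n₂) v) : n = [] := by
    by_contra hn
    obtain ⟨w, -, h₃⟩ := isPath_append.1 h₁
    obtain ⟨w', h₄, -⟩ := isPath_append.1 h₂
    obtain rfl := h₃.finish_unique h₄ hn
    exact hn (h₄.eq_nil hG)
  rcases List.append_eq_append_iff.1 h with ⟨n, rfl, rfl⟩ | ⟨n, rfl, rfl⟩
  · simp [eq_nil_of_overlap hm₁ hl₂]
  · simp [eq_nil_of_overlap hl₁ hm₂]

theorem IsAcyclic.exists_height [Finite V] (hG : G.IsAcyclic) :
    ∃ t : V → ℕ, ∀ e, t (G.tail e) < t (G.head e) := by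
  refine ⟨fun v =>
    {u | Relation.TransGen (fun u w => ∃ e, G.tail e = u ∧ G.head e = w) u v}.ncard, fun e => ?_⟩
  refine Set.ncard_lt_ncard ⟨fun u hu => hu.tail ⟨e, rfl, rfl⟩, fun h => ?_⟩ (Set.toFinite _)
  exact hG _ (h (.single ⟨e, rfl, rfl⟩))

theorem IsAcyclic.exists_depth [Finite V] (hG : G.IsAcyclic) :
    ∃ t : V → ℕ, ∀ e, t (G.head e) < t (G.tail e) := by
  refine ⟨fun u =>
    {v | Relation.TransGen (fun u w => ∃ e, G.tail e = u ∧ G.head e = w) u v}.ncard, fun e => ?_⟩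
  refine Set.ncard_lt_ncard ⟨fun v hv => hv.head ⟨e, rfl, rfl⟩, fun h => ?_⟩ (Set.toFinite _)
  exact hG _ (h (.single ⟨e, rfl, rfl⟩))

theorem Route.ext_edges {p q : G.Route} (hp : p.edges ≠ []) (h : p.edges = q.edges) : p = q := by
  have hq : G.IsPath q.start p.edges q.finish := h ▸ q.isPath
  exact Route.ext (p.isPath.start_unique hq hp) h (p.isPath.finish_unique hq hp)

theorem Route.edges_ne_nil (hGne : ∀ v, G.IsSource v → ¬ G.IsSink v) (p : G.Route) :
    p.edges ≠ [] := by
  intro h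
  have hp : p.start = p.finish := by simpa only [h, IsPath] using p.isPath
  exact hGne _ p.isSource (hp ▸ p.isSink)

theorem Route.finite [Finite V] [Finite E] (hG : G.IsAcyclic) : Finite G.Route := by
  have := Fintype.ofFinite E
  have : Finite {l : List E // l.Nodup} := Fintype.finite fintypeNodupList
  refine Finite.of_injective (β := V × {l : List E // l.Nodup} × V)
    (fun p => (p.start, ⟨p.edges, p.isPath.nodup hG⟩, p.finish)) fun p q h => ?_
  simp only [Prod.mk.injEq, Subtype.mk.injEq] at h
  exact Route.ext h.1 h.2.1 h.2.2

theorem Route.indicator_eq_count (hG : G.IsAcyclic) (p : G.Route) (e : E) :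
    p.indicator e = p.edges.count e := by
  simp [Route.indicator, (p.isPath.nodup hG).count]

/-- The net flow of `F` out of the vertex `v`. -/
def netflow [Fintype E] (G : DirectedMultigraph V E) (v : V) : (E → ℝ) →ₗ[ℝ] ℝ :=
  ∑ e with G.tail e = v, LinearMap.proj e - ∑ e with G.head e = v, LinearMap.proj e

theorem netflow_apply [Fintype E] (v : V) (F : E → ℝ) :
    G.netflow v F = ∑ e with G.tail e = v, F e - ∑ e with G.head e = v, F e := by
  simp [netflow]

theorem IsPath.netflow_count [Fintype E] {u w : V} {l : List E} (h : G.IsPath u l w) (v : V) :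
    G.netflow v (fun e => (l.count e : ℝ)) =
      (if u = v then 1 else 0) - (if w = v then 1 else 0) := by
  rw [netflow_apply]
  induction l generalizing u with
  | nil => simp [show u = w from h]
  | cons f l ih =>
    have hl := ih h.2
    obtain ⟨rfl, -⟩ := h
    simp only [List.count_cons, Nat.cast_add, Finset.sum_add_distrib, beq_iff_eq, Nat.cast_ite,
      Nat.cast_one, Nat.cast_zero, Finset.sum_ite_eq, Finset.mem_filter, Finset.mem_univ,
      true_and]
    linarith

theorem Route.netflow_indicator [Fintype E] (hG : G.IsAcyclic) (p : G.Route) (v : V) :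
    G.netflow v p.indicator = (if p.start = v then 1 else 0) - (if p.finish = v then 1 else 0) := by
  rw [← p.isPath.netflow_count v, funext (p.indicator_eq_count hG)]

/-! ### The orders on paths -/

/-- The lists `p` and `q` are compared by `r` at the first position in which they differ. -/
def FirstDiffLT (r : E → E → Prop) (p q : List E) : Prop :=
  ∃ (σ p' q' : List E) (f g : E), p = σ ++ f :: p' ∧ q = σ ++ g :: q' ∧ r f g

section FirstDiff

variable {r : E → E → Prop}

theorem not_firstDiffLT_nil (l : List E) : ¬ FirstDiffLT r l [] := by
  rintro ⟨σ, l', m', f, g, -, h, -⟩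
  simp at h

theorem firstDiffLT_cons_cons {e f : E} {l m : List E} :
    FirstDiffLT r (e :: l) (f :: m) ↔ r e f ∨ e = f ∧ FirstDiffLT r l m := by
  constructor
  · rintro ⟨_ | ⟨d, σ⟩, l', m', f', g', hl, hm, h⟩ <;>
      simp only [List.nil_append, List.cons_append, List.cons.injEq] at hl hm
    · exact Or.inl (hl.1 ▸ hm.1 ▸ h)
    · exact Or.inr ⟨hl.1.trans hm.1.symm, σ, l', m', f', g', hl.2, hm.2, h⟩
  · rintro (h | ⟨rfl, σ, l', m', f, g, rfl, rfl, h⟩)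
    · exact ⟨[], l, m, e, f, rfl, rfl, h⟩
    · exact ⟨e :: σ, l', m', f, g, rfl, rfl, h⟩

theorem FirstDiffLT.irrefl [Std.Irrefl r] (l : List E) : ¬ FirstDiffLT r l l := by
  rintro ⟨σ, l', m', f, g, rfl, h, hfg⟩
  obtain ⟨rfl, -⟩ := List.cons.inj (List.append_cancel_left h)
  exact _root_.irrefl f hfg

theorem FirstDiffLT.trans [IsTrans E r] {l m n : List E} (hlm : FirstDiffLT r l m)
    (hmn : FirstDiffLT r m n) : FirstDiffLT r l n := by
  induction l generalizing m n with
  | nil => simp [FirstDiffLT] at hlm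
  | cons e l ih =>
    rcases m with _ | ⟨f, m⟩
    · exact absurd hlm (not_firstDiffLT_nil _)
    rcases n with _ | ⟨g, n⟩
    · exact absurd hmn (not_firstDiffLT_nil _)
    rw [firstDiffLT_cons_cons] at hlm hmn ⊢
    rcases hlm with hef | ⟨rfl, hlm⟩ <;> rcases hmn with hfg | ⟨rfl, hmn⟩
    · exact Or.inl (_root_.trans hef hfg)
    · exact Or.inl hef
    · exact Or.inl hfg
    · exact Or.inr ⟨rfl, ih hlm hmn⟩

theorem sum_map_mul_pow_lt {ρ κ : E → ℕ} {N k : ℕ} (hρ : ∀ e, ρ e ≤ N) {l : List E}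
    (hl : l.Pairwise fun e f => κ f < κ e) (hk : ∀ e ∈ l, κ e < k) :
    (l.map fun e => ρ e * (N + 1) ^ κ e).sum < (N + 1) ^ k := by
  induction l generalizing k with
  | nil => simp
  | cons e l ih =>
    obtain ⟨hel, hl⟩ := List.pairwise_cons.1 hl
    have hle := Nat.mul_le_mul_right ((N + 1) ^ κ e) (hρ e)
    have hsum := ih hl hel
    calc _ < N * (N + 1) ^ κ e + (N + 1) ^ κ e := by
          simp only [List.map_cons, List.sum_cons]
          omega
      _ = (N + 1) ^ (κ e + 1) := by ring
      _ ≤ (N + 1) ^ k := Nat.pow_le_pow_right (Nat.succ_pos N) (hk e List.mem_cons_self)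

/-- The entries of a list serve as digits: `κ` gives the position of a digit, and its rank among the
entries comparable to it is the value of the digit. -/
theorem FirstDiffLT.exists_sum_lt [Finite E] [IsStrictOrder E r] {κ : E → ℕ}
    (hκ : ∀ e f, r e f → κ e = κ f) :
    ∃ α : E → ℕ, ∀ l m : List E, l.Pairwise (fun e f => κ f < κ e) → FirstDiffLT r l m →
      (l.map α).sum < (m.map α).sum := by
  have := Fintype.ofFinite E
  let N := Fintype.card E
  let ρ (e : E) : ℕ := #{f | r f e}
  have hρ_le (e : E) : ρ e ≤ N := Finset.card_le_univ _
  have hρ_lt {e f : E} (h : r e f) : ρ e < ρ f := by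
    refine Finset.card_lt_card ⟨fun g hg => ?_, fun hs => ?_⟩
    · simp only [Finset.mem_filter_univ] at hg ⊢
      exact _root_.trans hg h
    · exact _root_.irrefl e (by simpa using @hs e (by simpa using h))
  refine ⟨fun e => ρ e * (N + 1) ^ κ e, ?_⟩
  rintro _ _ hl ⟨σ, l, m, f, g, rfl, rfl, hfg⟩
  obtain ⟨hfl, hl⟩ := List.pairwise_cons.1 (List.pairwise_append.1 hl).2.1
  have hsum := sum_map_mul_pow_lt hρ_le hl hfl
  have hle := Nat.mul_le_mul_right ((N + 1) ^ κ f) (hρ_lt hfg)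
  rw [Nat.succ_mul] at hle
  simp only [List.map_append, List.map_cons, List.sum_append, List.sum_cons, ← hκ f g hfg]
  omega

end FirstDiff

namespace Framing

variable {Φ : G.Framing}

theorem OutLT.tail_eq {e f : E} (h : Φ.OutLT e f) : G.tail e = G.tail f := by
  obtain ⟨v, -, he, hf, -⟩ := h
  exact he.trans hf.symm

theorem InLT.head_eq {e f : E} (h : Φ.InLT e f) : G.head e = G.head f := by
  obtain ⟨v, -, he, hf, -⟩ := h
  exact he.trans hf.symm

instance : IsStrictOrder E Φ.OutLT where
  irrefl := by
    rintro e ⟨v, hv, _, _, h⟩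
    let := Φ.outOrder v hv
    exact lt_irrefl _ h
  trans := by
    rintro e f g ⟨v, hv, he, rfl, h⟩ ⟨_, _, rfl, hg, h'⟩
    let := Φ.outOrder _ hv
    exact ⟨_, hv, he, hg, lt_trans h h'⟩

instance : IsStrictOrder E Φ.InLT where
  irrefl := by
    rintro e ⟨v, hv, _, _, h⟩
    let := Φ.inOrder v hv
    exact lt_irrefl _ h
  trans := by
    rintro e f g ⟨v, hv, he, rfl, h⟩ ⟨_, _, rfl, hg, h'⟩
    let := Φ.inOrder _ hv
    exact ⟨_, hv, he, hg, lt_trans h h'⟩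

theorem outLT_trichotomous {e f : E} (h : G.tail e = G.tail f) :
    Φ.OutLT e f ∨ e = f ∨ Φ.OutLT f e := by
  let := Φ.outOrder _ (not_isSink_tail (G := G) f)
  refine (lt_trichotomy (⟨e, h⟩ : {g : E // G.tail g = G.tail f}) ⟨f, rfl⟩).imp ?_ (Or.imp ?_ ?_)
  · exact fun hlt => ⟨_, _, _, _, hlt⟩
  · exact congrArg Subtype.val
  · exact fun hlt => ⟨_, _, _, _, hlt⟩

theorem inLT_trichotomous {e f : E} (h : G.head e = G.head f) (hf : ¬ G.IsSink (G.head f)) :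
    Φ.InLT e f ∨ e = f ∨ Φ.InLT f e := by
  let := Φ.inOrder _ ⟨not_isSource_head (G := G) f, hf⟩
  refine (lt_trichotomy (⟨e, h⟩ : {g : E // G.head g = G.head f}) ⟨f, rfl⟩).imp ?_ (Or.imp ?_ ?_)
  · exact fun hlt => ⟨_, _, _, _, hlt⟩
  · exact congrArg Subtype.val
  · exact fun hlt => ⟨_, _, _, _, hlt⟩

theorem preLT_iff {l m : List E} :
    Φ.PreLT l m ↔ FirstDiffLT Φ.InLT l.reverse m.reverse := by
  constructor
  · rintro ⟨σ, l', m', f, g, rfl, rfl, h⟩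
    exact ⟨σ.reverse, l'.reverse, m'.reverse, f, g, by simp, by simp, h⟩
  · rintro ⟨σ, l', m', f, g, hl, hm, h⟩
    refine ⟨σ.reverse, l'.reverse, m'.reverse, f, g, ?_, ?_, h⟩
    · simpa using congrArg List.reverse hl
    · simpa using congrArg List.reverse hm

theorem preLT_concat_concat {e f : E} {l m : List E} :
    Φ.PreLT (l ++ [e]) (m ++ [f]) ↔ Φ.InLT e f ∨ e = f ∧ Φ.PreLT l m := by
  simp [preLT_iff, firstDiffLT_cons_cons]

theorem postLT_cons_cons {e f : E} {l m : List E} :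
    Φ.PostLT (e :: l) (f :: m) ↔ Φ.OutLT e f ∨ e = f ∧ Φ.PostLT l m :=
  firstDiffLT_cons_cons

theorem preLT_irrefl (l : List E) : ¬ Φ.PreLT l l := fun h =>
  FirstDiffLT.irrefl _ (preLT_iff.1 h)

theorem postLT_irrefl (l : List E) : ¬ Φ.PostLT l l := FirstDiffLT.irrefl l

theorem PostLT.trans {l m n : List E} (h : Φ.PostLT l m) (h' : Φ.PostLT m n) : Φ.PostLT l n :=
  FirstDiffLT.trans h h'

theorem preLT_trichotomous {u u' v : V} {l m : List E} (hl : G.IsPath u l v)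
    (hm : G.IsPath u' m v) (hu : G.IsSource u) (hu' : G.IsSource u') (hv : ¬ G.IsSink v) :
    Φ.PreLT l m ∨ l = m ∨ Φ.PreLT m l := by
  induction l using List.reverseRecOn generalizing v m with
  | nil =>
    obtain rfl := hm.eq_nil_of_isSource ((show u = v from hl) ▸ hu)
    exact Or.inr (Or.inl rfl)
  | append_singleton l e ih =>
    rcases m.eq_nil_or_concat' with rfl | ⟨m, f, rfl⟩
    · exact Or.inr (Or.inl (hl.eq_nil_of_isSource ((show u' = v from hm) ▸ hu')))
    obtain ⟨hl, he⟩ := isPath_concat.1 hl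
    obtain ⟨hm, hf⟩ := isPath_concat.1 hm
    simp only [preLT_concat_concat]
    rcases inLT_trichotomous (he.trans hf.symm) (hf ▸ hv) with hef | rfl | hfe
    · exact Or.inl (Or.inl hef)
    · simpa using (ih hl hm (not_isSink_tail e)).imp Or.inr (Or.imp_right Or.inr)
    · exact Or.inr (Or.inr (Or.inl hfe))

theorem postLT_trichotomous {u v v' : V} {l m : List E} (hl : G.IsPath u l v)
    (hm : G.IsPath u m v') (hv : G.IsSink v) (hv' : G.IsSink v') :
    Φ.PostLT l m ∨ l = m ∨ Φ.PostLT m l := by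
  induction l generalizing u m with
  | nil =>
    obtain rfl := hm.eq_nil_of_isSink ((show u = v from hl) ▸ hv)
    exact Or.inr (Or.inl rfl)
  | cons e l ih =>
    rcases m with _ | ⟨f, m⟩
    · exact Or.inr (Or.inl (hl.eq_nil_of_isSink ((show u = v' from hm) ▸ hv')))
    simp only [postLT_cons_cons]
    rcases outLT_trichotomous (hl.1.trans hm.1.symm) with hef | rfl | hfe
    · exact Or.inl (Or.inl hef)
    · simpa using (ih hl.2 hm.2).imp Or.inr (Or.imp_right Or.inr)
    · exact Or.inr (Or.inr (Or.inl hfe))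

variable (Φ) in
theorem exists_sum_lt_of_preLT [Finite V] [Finite E] (hG : G.IsAcyclic) :
    ∃ α : E → ℕ, ∀ (u v : V) (l m : List E), G.IsPath u l v → Φ.PreLT l m →
      (l.map α).sum < (m.map α).sum := by
  obtain ⟨t, ht⟩ := hG.exists_height
  obtain ⟨α, hα⟩ := FirstDiffLT.exists_sum_lt (r := Φ.InLT) (κ := fun e => t (G.head e))
    fun e f h => congrArg t h.head_eq
  refine ⟨α, fun u v l m hl hlm => ?_⟩
  have hdecr : l.reverse.Pairwise fun e f => t (G.head f) < t (G.head e) :=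
    List.pairwise_reverse.2 <| hl.pairwise.imp fun ⟨_, h⟩ =>
      (h.monotone fun e => (ht e).le).trans_lt (ht _)
  simpa only [List.map_reverse, List.sum_reverse] using hα _ _ hdecr (preLT_iff.1 hlm)

variable (Φ) in
theorem exists_sum_lt_of_postLT [Finite V] [Finite E] (hG : G.IsAcyclic) :
    ∃ β : E → ℕ, ∀ (u v : V) (l m : List E), G.IsPath u l v → Φ.PostLT l m →
      (l.map β).sum < (m.map β).sum := by
  obtain ⟨t, ht⟩ := hG.exists_depth
  obtain ⟨β, hβ⟩ := FirstDiffLT.exists_sum_lt (r := Φ.OutLT) (κ := fun e => t (G.tail e))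
    fun e f h => congrArg t h.tail_eq
  refine ⟨β, fun u v l m hl hlm => hβ l m (hl.pairwise.imp ?_) hlm⟩
  rintro e f ⟨_, h⟩
  have hle : t (G.tail f) ≤ t (G.head e) :=
    h.monotone (t := OrderDual.toDual ∘ t) fun e => (ht e).le
  exact hle.trans_lt (ht e)

end Framing

/-! ### Decomposition of flows along cliques -/

theorem Route.indicator_of_mem {p : G.Route} {e : E} (h : e ∈ p.edges) : p.indicator e = 1 :=
  if_pos h

theorem Route.indicator_of_notMem {p : G.Route} {e : E} (h : e ∉ p.edges) : p.indicator e = 0 :=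
  if_neg h

theorem Route.indicator_nonneg (p : G.Route) : 0 ≤ p.indicator := by
  intro e
  by_cases he : e ∈ p.edges
  · simp [indicator_of_mem he]
  · simp [indicator_of_notMem he]

/-- The vector on the edges obtained by sending `c p` units along each route `p`. -/
def routeFlow [Fintype G.Route] : (G.Route → ℝ) →ₗ[ℝ] (E → ℝ) :=
  Fintype.linearCombination ℝ Route.indicator

theorem routeFlow_apply [Fintype G.Route] (c : G.Route → ℝ) (e : E) :
    routeFlow c e = ∑ p, c p * p.indicator e := by
  simp [routeFlow, Fintype.linearCombination_apply]

theorem routeFlow_single [Fintype G.Route] (p : G.Route) :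
    routeFlow (Pi.single p 1) = p.indicator := by
  simp [routeFlow, Fintype.linearCombination_apply_single]

theorem routeFlow_nonneg [Fintype G.Route] {c : G.Route → ℝ} (hc : 0 ≤ c) : 0 ≤ routeFlow c := by
  intro e
  rw [routeFlow_apply]
  exact Finset.sum_nonneg fun p _ => mul_nonneg (hc p) (p.indicator_nonneg e)

theorem le_routeFlow [Fintype G.Route] {c : G.Route → ℝ} (hc : 0 ≤ c) {p : G.Route} {e : E}
    (he : e ∈ p.edges) : c p ≤ routeFlow c e := by
  rw [routeFlow_apply]
  simpa [Route.indicator_of_mem he] using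
    Finset.single_le_sum (f := fun q : G.Route => c q * q.indicator e)
      (fun q _ => mul_nonneg (hc q) (q.indicator_nonneg e)) (Finset.mem_univ p)

theorem netflow_routeFlow [Fintype E] [Fintype G.Route] (hG : G.IsAcyclic) (c : G.Route → ℝ)
    (v : V) :
    G.netflow v (routeFlow c) = ∑ p with p.start = v, c p - ∑ p with p.finish = v, c p := by
  simp only [routeFlow, Fintype.linearCombination_apply, map_sum, map_smul,
    Route.netflow_indicator hG, smul_eq_mul, mul_sub, mul_ite, mul_one, mul_zero,
    Finset.sum_sub_distrib, Finset.sum_filter]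

/-- A flow with arbitrary supplies at the sources and arbitrary demands at the sinks: a nonnegative
function on the edges that is conserved at the internal vertices. -/
structure IsFlow [Fintype E] (G : DirectedMultigraph V E) (F : E → ℝ) : Prop where
  nonneg : 0 ≤ F
  conserved : ∀ v, G.IsInternal v → G.netflow v F = 0

theorem IsFlow.sub_routeFlow [Fintype E] [Fintype G.Route] (hG : G.IsAcyclic) {F : E → ℝ}
    (hF : G.IsFlow F) {c : G.Route → ℝ} (hc : routeFlow c ≤ F) : G.IsFlow (F - routeFlow c) := by
  refine ⟨sub_nonneg.2 hc, fun v hv => ?_⟩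
  have hstart (p : G.Route) : p.start ≠ v := fun h => hv.1 (h ▸ p.isSource)
  have hfinish (p : G.Route) : p.finish ≠ v := fun h => hv.2 (h ▸ p.isSink)
  simp [map_sub, hF.conserved v hv, netflow_routeFlow hG, hstart, hfinish]

theorem IsFlow.exists_pos_in_iff_out [Fintype E] {F : E → ℝ} (hF : G.IsFlow F) {v : V}
    (hv : G.IsInternal v) : (∃ e, G.head e = v ∧ 0 < F e) ↔ ∃ e, G.tail e = v ∧ 0 < F e := by
  have hcons := hF.conserved v hv
  rw [netflow_apply, sub_eq_zero] at hcons
  simpa [Finset.sum_pos_iff_of_nonneg fun e _ => hF.nonneg e] using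
    (congrArg (0 < ·) hcons).to_iff.symm

theorem IsFlow.exists_route [Fintype E] (hG : G.IsAcyclic) {F : E → ℝ} (hF : G.IsFlow F) {e : E}
    (he : 0 < F e) : ∃ p : G.Route, ∀ f ∈ p.edges, 0 < F f := by
  -- A longest path on which the flow is positive is a route.
  let S : Set (List E) := {l | l ≠ [] ∧ (∃ u v, G.IsPath u l v) ∧ ∀ f ∈ l, 0 < F f}
  have hfin : S.Finite := by
    have : Finite {l : List E | l.Nodup} := Fintype.finite fintypeNodupList
    exact (Set.toFinite {l : List E | l.Nodup}).subset
      fun l ⟨_, ⟨u, v, hl⟩, _⟩ => hl.nodup hG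
  obtain ⟨l, ⟨hne, ⟨u, v, hl⟩, hpos⟩, hmax⟩ :=
    hfin.exists_maximalFor List.length S ⟨[e], by simp, ⟨_, _, rfl, rfl⟩, by simpa⟩
  refine ⟨⟨u, l, v, ?_, ?_, hl⟩, hpos⟩
  · by_contra hu
    obtain ⟨f, m, rfl⟩ := List.exists_cons_of_ne_nil hne
    obtain ⟨rfl, hm⟩ := hl
    obtain ⟨g, hg, hgpos⟩ := (hF.exists_pos_in_iff_out ⟨hu, not_isSink_tail f⟩).2
      ⟨f, rfl, hpos f List.mem_cons_self⟩
    have hlonger : g :: f :: m ∈ S :=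
      ⟨by simp, ⟨_, v, rfl, hg.symm, hm⟩, List.forall_mem_cons.2 ⟨hgpos, hpos⟩⟩
    simpa using hmax hlonger (by simp)
  · by_contra hv
    obtain ⟨m, f, rfl⟩ := l.eq_nil_or_concat'.resolve_left hne
    obtain ⟨-, rfl⟩ := isPath_concat.1 hl
    obtain ⟨g, hg, hgpos⟩ := (hF.exists_pos_in_iff_out ⟨not_isSource_head f, hv⟩).1
      ⟨f, rfl, hpos f (by simp)⟩
    have hlonger : m ++ [f] ++ [g] ∈ S :=
      ⟨by simp, ⟨u, _, isPath_concat.2 ⟨hg ▸ hl, rfl⟩⟩,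
        List.forall_mem_append.2 ⟨hpos, by simpa using hgpos⟩⟩
    simpa using hmax hlonger (by simp)

/-- The route that follows `p` up to the vertex `i` and `q` from there on. -/
def Route.splice {p q : G.Route} {i : V} {p₁ p₂ q₁ q₂ : List E} (hp : p.SplitsAt i p₁ p₂)
    (hq : q.SplitsAt i q₁ q₂) : G.Route :=
  ⟨p.start, p₁ ++ q₂, q.finish, p.isSource, q.isSink, isPath_append.2 ⟨i, hp.2.1, hq.2.2⟩⟩

theorem Route.indicator_splice_add (hG : G.IsAcyclic) {p q : G.Route} {i : V}
    {p₁ p₂ q₁ q₂ : List E} (hp : p.SplitsAt i p₁ p₂) (hq : q.SplitsAt i q₁ q₂) :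
    (splice hp hq).indicator + (splice hq hp).indicator = p.indicator + q.indicator := by
  ext e
  simp only [Pi.add_apply, indicator_eq_count hG, splice, hp.1, hq.1, List.count_append,
    Nat.cast_add]
  ring

/-- The sum of the products `α e * β f` over all pairs of entries with `e` before `f`. -/
def pairSum (α β : E → ℕ) : List E → ℕ
  | [] => 0
  | e :: l => α e * (l.map β).sum + pairSum α β l

theorem pairSum_append (α β : E → ℕ) (l m : List E) :
    pairSum α β (l ++ m) = pairSum α β l + (l.map α).sum * (m.map β).sum + pairSum α β m := by
  induction l with
  | nil => simp [pairSum]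
  | cons e l ih =>
    simp only [List.cons_append, pairSum, ih, List.map_append, List.sum_append, List.map_cons,
      List.sum_cons]
    ring

theorem Framing.exists_uncrossing_weight [Finite V] [Finite E] (hG : G.IsAcyclic)
    (Φ : G.Framing) : ∃ w : G.Route → ℝ, (∀ p, 0 < w p) ∧
      ∀ (p q : G.Route) (i : V) (p₁ p₂ q₁ q₂ : List E) (hp : p.SplitsAt i p₁ p₂)
        (hq : q.SplitsAt i q₁ q₂), Φ.PreLT p₁ q₁ → Φ.PostLT q₂ p₂ →
        w p + w q < w (Route.splice hp hq) + w (Route.splice hq hp) := by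
  obtain ⟨α, hα⟩ := Φ.exists_sum_lt_of_preLT hG
  obtain ⟨β, hβ⟩ := Φ.exists_sum_lt_of_postLT hG
  refine ⟨fun p => 1 + pairSum α β p.edges, fun p => by positivity, ?_⟩
  intro p q i p₁ p₂ q₁ q₂ hp hq hpre hpost
  have hlt : pairSum α β (p₁ ++ p₂) + pairSum α β (q₁ ++ q₂) <
      pairSum α β (p₁ ++ q₂) + pairSum α β (q₁ ++ p₂) := by
    simp only [pairSum_append]
    linarith [mul_add_mul_lt_mul_add_mul (hα _ _ _ _ hp.2.1 hpre) (hβ _ _ _ _ hq.2.2 hpost)]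
  have hlt' : (pairSum α β (p₁ ++ p₂) + pairSum α β (q₁ ++ q₂) : ℝ) <
      pairSum α β (p₁ ++ q₂) + pairSum α β (q₁ ++ p₂) := mod_cast hlt
  simp only [hp.1, hq.1, Route.splice]
  linarith

/-- The ways to send part of `F` along routes. -/
def partialDecompositions [Fintype G.Route] (F : E → ℝ) : Set (G.Route → ℝ) :=
  {c | 0 ≤ c ∧ routeFlow c ≤ F}

section PartialDecompositions

variable [Fintype G.Route] {F : E → ℝ} {c : G.Route → ℝ}

theorem isCompact_partialDecompositions (hne : ∀ p : G.Route, p.edges ≠ []) (F : E → ℝ) :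
    IsCompact (partialDecompositions (G := G) F) := by
  have hclosed : IsClosed (partialDecompositions (G := G) F) :=
    isClosed_Ici.inter (isClosed_Iic.preimage (LinearMap.continuous_on_pi routeFlow))
  choose e he using fun p : G.Route => List.exists_mem_of_ne_nil _ (hne p)
  refine isCompact_Icc.of_isClosed_subset hclosed (s := Set.Icc 0 fun p => F (e p)) ?_
  exact fun c hc => ⟨hc.1, fun p => (le_routeFlow hc.1 (he p)).trans (hc.2 _)⟩

theorem isRouteClique_of_isMaxOn (hG : G.IsAcyclic) {Φ : G.Framing} {w : G.Route → ℝ}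
    (hw : ∀ (p q : G.Route) (i : V) (p₁ p₂ q₁ q₂ : List E) (hp : p.SplitsAt i p₁ p₂)
      (hq : q.SplitsAt i q₁ q₂), Φ.PreLT p₁ q₁ → Φ.PostLT q₂ p₂ →
      w p + w q < w (Route.splice hp hq) + w (Route.splice hq hp))
    (hc : c ∈ partialDecompositions F)
    (hmax : IsMaxOn (fun c => c ⬝ᵥ w) (partialDecompositions F) c) :
    Φ.IsRouteClique {p | c p ≠ 0} := by
  have not_crossing {p q : G.Route} {i : V} {p₁ p₂ q₁ q₂ : List E} (hcp : c p ≠ 0)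
      (hcq : c q ≠ 0) (hp : p.SplitsAt i p₁ p₂) (hq : q.SplitsAt i q₁ q₂)
      (hpre : Φ.PreLT p₁ q₁) (hpost : Φ.PostLT q₂ p₂) : False := by
    have hpq : p ≠ q := by
      rintro rfl
      obtain ⟨rfl, -⟩ := hp.2.1.split_unique hG hp.2.2 hq.2.1 hq.2.2 (hp.1.symm.trans hq.1)
      exact Framing.preLT_irrefl p₁ hpre
    let ε := min (c p) (c q)
    have hε : 0 < ε := lt_min ((hc.1 p).lt_of_ne' hcp) ((hc.1 q).lt_of_ne' hcq)
    let new : G.Route → ℝ := Pi.single (Route.splice hp hq) 1 + Pi.single (Route.splice hq hp) 1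
    let old : G.Route → ℝ := Pi.single p 1 + Pi.single q 1
    have hnew : 0 ≤ new :=
      add_nonneg (Pi.single_nonneg.2 zero_le_one) (Pi.single_nonneg.2 zero_le_one)
    have hold : ε • old ≤ c := by
      intro r
      by_cases hrp : r = p
      · simp [old, hrp, hpq, ε]
      · by_cases hrq : r = q
        · simp [old, hrq, hpq.symm, ε]
        · simpa [old, hrp, hrq] using hc.1 r
    have hflow : routeFlow new = routeFlow old := by
      simp [new, old, routeFlow_single, Route.indicator_splice_add hG hp hq]
    have hle := hmax (a := c - ε • old + ε • new)
      ⟨add_nonneg (sub_nonneg.2 hold) (smul_nonneg hε.le hnew), by simpa [hflow] using hc.2⟩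
    simp only [add_dotProduct, sub_dotProduct, smul_dotProduct, smul_eq_mul, new, old,
      single_dotProduct, one_mul, Set.mem_ofPred_eq] at hle
    nlinarith [hw p q i p₁ p₂ q₁ q₂ hp hq hpre hpost]
  rintro p hp q hq i ⟨p₁, p₂, q₁, q₂, hps, hqs, ⟨hpre, hpost⟩ | ⟨hpre, hpost⟩⟩
  · exact not_crossing hp hq hps hqs hpre hpost
  · exact not_crossing hq hp hqs hps hpre hpost

theorem routeFlow_eq_of_isMaxOn [Fintype E] (hG : G.IsAcyclic)
    (hne : ∀ p : G.Route, p.edges ≠ []) (hF : G.IsFlow F) {w : G.Route → ℝ} (hw : ∀ p, 0 < w p)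
    (hc : c ∈ partialDecompositions F)
    (hmax : IsMaxOn (fun c => c ⬝ᵥ w) (partialDecompositions F) c) : routeFlow c = F := by
  by_contra hlt
  obtain ⟨e, he⟩ := (Pi.lt_def.1 (lt_of_le_of_ne hc.2 hlt)).2
  obtain ⟨p, hp⟩ := (hF.sub_routeFlow hG hc.2).exists_route hG (sub_pos.2 he)
  obtain ⟨f, hf, hmin⟩ := p.edges.toFinset.exists_min_image (F - routeFlow c)
    (by simpa using hne p)
  let ε := (F - routeFlow c) f
  have hε : 0 < ε := hp f (by simpa using hf)
  have hle := hmax (a := c + ε • Pi.single p 1)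
    ⟨add_nonneg hc.1 (smul_nonneg hε.le (Pi.single_nonneg.2 zero_le_one)), fun g => ?_⟩
  · simp only [add_dotProduct, smul_dotProduct, single_dotProduct, one_mul, smul_eq_mul,
      Set.mem_ofPred_eq] at hle
    nlinarith [hw p]
  · rw [map_add, map_smul, routeFlow_single, Pi.add_apply, Pi.smul_apply, smul_eq_mul]
    by_cases hg : g ∈ p.edges
    · rw [Route.indicator_of_mem hg, mul_one]
      simpa [le_sub_iff_add_le', ε] using hmin g (by simpa using hg)
    · simpa [Route.indicator_of_notMem hg] using hc.2 g

theorem IsFlow.exists_decomposition [Finite V] [Fintype E] (hG : G.IsAcyclic)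
    (hGne : ∀ v, G.IsSource v → ¬ G.IsSink v) (Φ : G.Framing) (hF : G.IsFlow F) :
    ∃ c : G.Route → ℝ, 0 ≤ c ∧ Φ.IsRouteClique {p | c p ≠ 0} ∧ routeFlow c = F := by
  have hne := Route.edges_ne_nil hGne
  obtain ⟨w, hwpos, hw⟩ := Φ.exists_uncrossing_weight hG
  obtain ⟨c, hc, hmax⟩ := (isCompact_partialDecompositions hne F).exists_isMaxOn
    ⟨0, le_rfl, by simpa using hF.nonneg⟩
    (continuous_id.dotProduct continuous_const : Continuous fun c => c ⬝ᵥ w).continuousOn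
  exact ⟨c, hc.1, isRouteClique_of_isMaxOn hG hw hc hmax,
    routeFlow_eq_of_isMaxOn hG hne hF hwpos hc hmax⟩

end PartialDecompositions

/-! ### Uniqueness and integrality of clique decompositions -/

/-- The total weight of the set `S` under the weight function `c`. -/
def weight {ι : Type*} [Fintype ι] (c : ι → ℝ) (S : Set ι) : ℝ := ∑ i with i ∈ S, c i

section Weight

variable {ι : Type*} [Fintype ι] {c : ι → ℝ}

theorem weight_union {S T : Set ι} (h : Disjoint S T) :
    weight c (S ∪ T) = weight c S + weight c T := by
  simp only [weight, Set.mem_union, Finset.filter_or]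
  exact Finset.sum_union (Finset.disjoint_filter.2 fun i _ hS hT => h.ne_of_mem hS hT rfl)

theorem weight_empty : weight c ∅ = 0 := by simp [weight]

theorem weight_singleton (i : ι) : weight c {i} = c i := by
  simp [weight, Finset.sum_filter]

theorem weight_inter_eq_left {S T : Set ι} (h : ∀ i ∈ S, c i ≠ 0 → i ∈ T) :
    weight c (S ∩ T) = weight c S := by
  simp only [weight, Finset.sum_filter, Set.mem_inter_iff]
  refine Finset.sum_congr rfl fun i _ => ?_
  by_cases hi : c i = 0
  · simp [hi]
  · simp only [and_iff_left_of_imp fun hS => h i hS hi]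

theorem weight_inter_le_left (hc : 0 ≤ c) (S T : Set ι) : weight c (S ∩ T) ≤ weight c S :=
  Finset.sum_le_sum_of_subset_of_nonneg (fun i hi => by simp_all) fun i _ _ => hc i

theorem weight_inter_eq_min (hc : 0 ≤ c) {S T : Set ι}
    (h : ∀ i j, c i ≠ 0 → c j ≠ 0 → i ∈ S → i ∉ T → j ∈ T → j ∈ S) :
    weight c (S ∩ T) = min (weight c S) (weight c T) := by
  by_cases hST : ∀ i ∈ S, c i ≠ 0 → i ∈ T
  · have hle := weight_inter_le_left hc T S
    rw [Set.inter_comm, weight_inter_eq_left hST] at hle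
    rw [weight_inter_eq_left hST, min_eq_left hle]
  · push Not at hST
    obtain ⟨i, hiS, hi, hiT⟩ := hST
    have hTS (j : ι) (hj : j ∈ T) (hcj : c j ≠ 0) : j ∈ S := h i j hi hcj hiS hiT hj
    have hle := weight_inter_le_left hc S T
    rw [Set.inter_comm, weight_inter_eq_left hTS] at hle ⊢
    exact (min_eq_right hle).symm

end Weight

theorem sum_routeFlow_eq_weight [Fintype E] [Fintype G.Route] (c : G.Route → ℝ) {P : E → Prop}
    [DecidablePred P] (hP : ∀ p : G.Route, ∀ e ∈ p.edges, ∀ f ∈ p.edges, P e → P f → e = f) :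
    ∑ e with P e, routeFlow c e = weight c {p | ∃ e ∈ p.edges, P e} := by
  simp only [routeFlow_apply, weight]
  rw [Finset.sum_comm, Finset.sum_filter]
  refine Finset.sum_congr rfl fun p _ => ?_
  rw [← Finset.mul_sum]
  split_ifs with h
  · obtain ⟨e, he, hPe⟩ := h
    rw [Finset.sum_eq_single_of_mem e (by simpa using hPe), Route.indicator_of_mem he, mul_one]
    intro f hf hfe
    exact Route.indicator_of_notMem fun hfp => hfe (hP p f hfp e he (by simpa using hf) hPe)
  · rw [Finset.sum_eq_zero, mul_zero]
    exact fun f hf => Route.indicator_of_notMem fun hfp => h ⟨f, hfp, by simpa using hf⟩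

/-- The routes through the vertex `v` whose part before `v` belongs to `D`. -/
def routesVia (v : V) (D : Set (List E)) : Set G.Route :=
  {p | ∃ p₁ p₂, p.SplitsAt v p₁ p₂ ∧ p₁ ∈ D}

/-- The routes along the edge `e` whose part before `e` belongs to `D`. -/
def routesAlong (e : E) (D : Set (List E)) : Set G.Route :=
  {p | ∃ p₁ p₂, p.edges = p₁ ++ e :: p₂ ∧ p₁ ∈ D}

theorem Route.SplitsAt.unique (hG : G.IsAcyclic) {p : G.Route} {v : V} {p₁ p₂ p₁' p₂' : List E}
    (h : p.SplitsAt v p₁ p₂) (h' : p.SplitsAt v p₁' p₂') : p₁ = p₁' ∧ p₂ = p₂' :=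
  h.2.1.split_unique hG h.2.2 h'.2.1 h'.2.2 (h.1.symm.trans h'.1)

theorem Route.eq_of_tail_eq (hG : G.IsAcyclic) {p : G.Route} {e f : E} (he : e ∈ p.edges)
    (hf : f ∈ p.edges) (h : G.tail e = G.tail f) : e = f :=
  List.inj_on_of_nodup_map (p.isPath.nodup_map_tail hG) he hf h

theorem Route.eq_of_head_eq (hG : G.IsAcyclic) {p : G.Route} {e f : E} (he : e ∈ p.edges)
    (hf : f ∈ p.edges) (h : G.head e = G.head f) : e = f :=
  List.inj_on_of_nodup_map (p.isPath.nodup_map_head hG) he hf h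

theorem Route.splitsAt_tail {p : G.Route} {e : E} {p₁ p₂ : List E} (h : p.edges = p₁ ++ e :: p₂) :
    p.SplitsAt (G.tail e) p₁ (e :: p₂) := by
  have hp := isPath_append_cons.1 (h ▸ p.isPath)
  exact ⟨h, hp.1, rfl, hp.2⟩

theorem Route.splitsAt_head {p : G.Route} {e : E} {p₁ p₂ : List E} (h : p.edges = p₁ ++ e :: p₂) :
    p.SplitsAt (G.head e) (p₁ ++ [e]) p₂ := by
  have hp := isPath_append_cons.1 (h ▸ p.isPath)
  exact ⟨by simpa using h, isPath_concat.2 ⟨hp.1, rfl⟩, hp.2⟩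

theorem routesVia_union (v : V) (D D' : Set (List E)) :
    (routesVia v (D ∪ D') : Set G.Route) = routesVia v D ∪ routesVia v D' := by
  ext p
  simp only [routesVia, Set.mem_union, Set.mem_ofPred_eq, and_or_left, exists_or]

theorem routesVia_empty (v : V) : (routesVia v ∅ : Set G.Route) = ∅ := by
  simp [routesVia]

theorem disjoint_routesVia (hG : G.IsAcyclic) (v : V) {D D' : Set (List E)} (h : Disjoint D D') :
    Disjoint (routesVia v D : Set G.Route) (routesVia v D') := by
  refine Set.disjoint_left.2 ?_
  rintro p ⟨p₁, p₂, hp, hD⟩ ⟨p₁', p₂', hp', hD'⟩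
  exact h.ne_of_mem hD hD' (hp.unique hG hp').1

theorem routesVia_of_isSource {v : V} (hv : G.IsSource v) (hv' : ¬ G.IsSink v) :
    (routesVia v {[]} : Set G.Route) = {p | ∃ e ∈ p.edges, G.tail e = v} := by
  ext p
  constructor
  · rintro ⟨_, _ | ⟨e, p₂⟩, ⟨hp, hp₁, hp₂⟩, rfl⟩
    · exact absurd ((show v = p.finish from hp₂) ▸ p.isSink) hv'
    · exact ⟨e, by simp [hp], hp₂.1⟩
  · rintro ⟨e, he, rfl⟩
    obtain ⟨p₁, p₂, hp⟩ := List.append_of_mem he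
    have hsplit := Route.splitsAt_tail hp
    exact ⟨p₁, e :: p₂, hsplit, hsplit.2.1.eq_nil_of_isSource hv⟩

theorem routesVia_finish_edges (hGne : ∀ v, G.IsSource v → ¬ G.IsSink v) (p : G.Route) :
    routesVia p.finish {p.edges} = {p} := by
  ext q
  constructor
  · rintro ⟨_, q₂, ⟨hq, -, hq₂⟩, rfl⟩
    rw [hq₂.eq_nil_of_isSink p.isSink, List.append_nil] at hq
    exact Route.ext_edges (q.edges_ne_nil hGne) hq
  · rintro rfl
    exact ⟨q.edges, [], ⟨(List.append_nil _).symm, q.isPath, rfl⟩, rfl⟩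

namespace Framing

variable (Φ : G.Framing)

/-- How many of the `x` lowest units of flow at the tail of `e` continue along `e`. -/
def share [Fintype E] (F : E → ℝ) (e : E) (x : ℝ) : ℝ :=
  min x (∑ f with Φ.OutLT f e ∨ f = e, F f) - min x (∑ f with Φ.OutLT f e, F f)

/-- The number of units of flow at the head of `e` that lie below the unit which enters along `e`
and has `x` units below it at the tail of `e`. -/
def transport [Fintype E] (F : E → ℝ) (x : ℝ) (e : E) : ℝ :=
  ∑ f with Φ.InLT f e, F f + Φ.share F e x

/-- The coefficient of a route in the clique decomposition of a flow. -/
def coefficient [Fintype E] (F : E → ℝ) (p : G.Route) : ℝ :=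
  p.edges.foldl (Φ.transport F) (∑ e with G.tail e = p.start, F e) -
    p.edges.foldl (Φ.transport F) 0

theorem coefficient_mem [Fintype E] {F : E → ℝ} {H : AddSubgroup ℝ} (hF : ∀ e, F e ∈ H)
    (p : G.Route) : Φ.coefficient F p ∈ H := by
  have hmin {x y : ℝ} (hx : x ∈ H) (hy : y ∈ H) : min x y ∈ H := by
    rcases min_choice x y with h | h <;> rwa [h]
  have hsum (s : Finset E) : ∑ e ∈ s, F e ∈ H := sum_mem fun e _ => hF e
  have hfold {x : ℝ} (hx : x ∈ H) : p.edges.foldl (Φ.transport F) x ∈ H :=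
    List.foldlRecOn p.edges _ hx fun y hy e _ =>
      add_mem (hsum _) (sub_mem (hmin hy (hsum _)) (hmin hy (hsum _)))
  exact sub_mem (hfold (hsum _)) (hfold (zero_mem H))

/-- A set of paths that is closed under passing to smaller paths in the pre-order. -/
def IsPreLower (D : Set (List E)) : Prop :=
  ∀ ⦃l m⦄, Φ.PreLT l m → m ∈ D → l ∈ D

/-- The paths ending in an edge below `e`, or in `e` after a path in `D`. -/
def extendLower (D : Set (List E)) (e : E) : Set (List E) :=
  {l | ∃ ρ f, l = ρ ++ [f] ∧ (Φ.InLT f e ∨ f = e ∧ ρ ∈ D)}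

variable {Φ}

theorem concat_mem_extendLower {D : Set (List E)} {ρ : List E} {e f : E} :
    ρ ++ [f] ∈ Φ.extendLower D e ↔ Φ.InLT f e ∨ f = e ∧ ρ ∈ D := by
  constructor
  · rintro ⟨ρ', f', h, hf⟩
    obtain ⟨rfl, hff'⟩ := List.append_inj' h rfl
    obtain rfl := List.singleton_inj.1 hff'
    exact hf
  · exact fun h => ⟨ρ, f, rfl, h⟩

theorem IsPreLower.extendLower {D : Set (List E)} (hD : Φ.IsPreLower D) (e : E) :
    Φ.IsPreLower (Φ.extendLower D e) := by
  rintro l _ hlt ⟨ρ, f, rfl, hf⟩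
  rcases l.eq_nil_or_concat' with rfl | ⟨l, g, rfl⟩
  · simp [PreLT] at hlt
  rw [concat_mem_extendLower]
  rcases preLT_concat_concat.1 hlt with hgf | ⟨rfl, hlρ⟩
  · rcases hf with hfe | ⟨rfl, -⟩
    · exact Or.inl (_root_.trans hgf hfe)
    · exact Or.inl hgf
  · exact hf.imp_right (And.imp_right (hD hlρ))

variable (Φ) in
theorem isPreLower_empty : Φ.IsPreLower ∅ := fun _ _ _ h => h

variable (Φ) in
theorem isPreLower_singleton_nil : Φ.IsPreLower {[]} := by
  rintro l _ ⟨σ, l', m', f, g, -, h, -⟩ rfl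
  simp at h

theorem foldl_extendLower_singleton_nil (l : List E) :
    l.foldl Φ.extendLower {[]} = l.foldl Φ.extendLower ∅ ∪ {l} := by
  induction l using List.reverseRecOn with
  | nil => simp
  | append_singleton l e ih =>
    ext m
    simp only [List.foldl_append, List.foldl_cons, List.foldl_nil, ih]
    rcases m.eq_nil_or_concat' with rfl | ⟨m, f, rfl⟩
    · simp [extendLower]
    · have hconcat : m ++ [f] = l ++ [e] ↔ f = e ∧ m = l := by simp [and_comm]
      simp only [concat_mem_extendLower, Set.mem_union, Set.mem_singleton_iff, hconcat, and_or_left,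
        or_assoc]

theorem notMem_foldl_extendLower_empty (l : List E) : l ∉ l.foldl Φ.extendLower ∅ := by
  induction l using List.reverseRecOn with
  | nil => simp
  | append_singleton l e ih =>
    simpa [concat_mem_extendLower, irrefl] using ih

theorem mem_routesVia_of_postLT {D : Set (List E)} (hD : Φ.IsPreLower D)
    {p q : G.Route} {v : V} (hv : ¬ G.IsSink v) {p₁ p₂ q₁ q₂ : List E} (hp : p.SplitsAt v p₁ p₂)
    (hq : q.SplitsAt v q₁ q₂) (hpq : ¬ Φ.IncompatibleAt p q v) (hlt : Φ.PostLT q₂ p₂)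
    (hp₁ : p₁ ∈ D) : q ∈ routesVia v D := by
  refine ⟨q₁, q₂, hq, ?_⟩
  rcases preLT_trichotomous (Φ := Φ) hp.2.1 hq.2.1 p.isSource q.isSource hv with h | rfl | h
  · exact absurd ⟨p₁, p₂, q₁, q₂, hp, hq, Or.inl ⟨h, hlt⟩⟩ hpq
  · exact hp₁
  · exact hD h hp₁

section RouteFlow

variable [Fintype E] [Fintype G.Route] {c : G.Route → ℝ}

theorem weight_routesVia_inter (hG : G.IsAcyclic) (hc : 0 ≤ c)
    (hclique : Φ.IsRouteClique {p | c p ≠ 0}) {D : Set (List E)} (hD : Φ.IsPreLower D) {e : E}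
    {P : E → Prop} [DecidablePred P] (htail : ∀ f, P f → G.tail f = G.tail e)
    (hlower : ∀ f g, P g → Φ.OutLT f g → P f) :
    weight c (routesVia (G.tail e) D ∩ {p | ∃ f ∈ p.edges, P f}) =
      min (weight c (routesVia (G.tail e) D)) (∑ f with P f, routeFlow c f) := by
  rw [sum_routeFlow_eq_weight c fun p f hf g hg hPf hPg =>
    Route.eq_of_tail_eq hG hf hg ((htail f hPf).trans (htail g hPg).symm)]
  refine weight_inter_eq_min hc ?_
  rintro p q hp hq ⟨p₁, _ | ⟨g, p₂⟩, hsplit, hp₁⟩ hpP ⟨f, hfq, hPf⟩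
  · exact absurd ((show G.tail e = p.finish from hsplit.2.2) ▸ p.isSink) (not_isSink_tail e)
  have hPg : ¬ P g := fun h => hpP ⟨g, by simp [hsplit.1], h⟩
  have hlt : Φ.OutLT f g := by
    rcases outLT_trichotomous (Φ := Φ) ((htail f hPf).trans hsplit.2.2.1.symm) with h | rfl | h
    · exact h
    · exact absurd hPf hPg
    · exact absurd (hlower _ _ hPf h) hPg
  obtain ⟨q₁, q₂, hq'⟩ := List.append_of_mem hfq
  exact mem_routesVia_of_postLT hD (not_isSink_tail e) hsplit
    (htail f hPf ▸ Route.splitsAt_tail hq') (hclique p hp q hq _)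
    (postLT_cons_cons.2 (Or.inl hlt)) hp₁

theorem share_routeFlow (hG : G.IsAcyclic) (hc : 0 ≤ c)
    (hclique : Φ.IsRouteClique {p | c p ≠ 0}) {D : Set (List E)} (hD : Φ.IsPreLower D) (e : E) :
    Φ.share (routeFlow c) e (weight c (routesVia (G.tail e) D)) = weight c (routesAlong e D) := by
  have hle (f : E) (hf : Φ.OutLT f e ∨ f = e) : G.tail f = G.tail e :=
    hf.elim OutLT.tail_eq (congrArg G.tail)
  rw [share,
    ← weight_routesVia_inter (e := e) hG hc hclique hD hle
      fun f g hg hfg => Or.inl (hg.elim (_root_.trans hfg) fun h => h ▸ hfg),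
    ← weight_routesVia_inter (e := e) hG hc hclique hD (fun f hf => hf.tail_eq)
      fun f g hg hfg => _root_.trans hfg hg,
    sub_eq_iff_eq_add, ← weight_union]
  · congr 1
    ext p
    constructor
    · rintro ⟨hp, f, hfp, hf | rfl⟩
      · exact Or.inr ⟨hp, f, hfp, hf⟩
      · obtain ⟨p₁, p₂, hsplit, hp₁⟩ := hp
        obtain ⟨l, m, hlm⟩ := List.append_of_mem hfp
        exact Or.inl ⟨l, m, hlm, (hsplit.unique hG (Route.splitsAt_tail hlm)).1 ▸ hp₁⟩
    · rintro (⟨p₁, p₂, hp, hp₁⟩ | ⟨hp, f, hfp, hf⟩)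
      · exact ⟨⟨p₁, e :: p₂, Route.splitsAt_tail hp, hp₁⟩, e, by simp [hp], Or.inr rfl⟩
      · exact ⟨hp, f, hfp, Or.inl hf⟩
  · refine Set.disjoint_left.2 ?_
    rintro p ⟨p₁, p₂, hp, -⟩ ⟨-, f, hfp, hf⟩
    obtain rfl := Route.eq_of_tail_eq hG (f := e) hfp (by simp [hp]) hf.tail_eq
    exact irrefl _ hf

theorem transport_routeFlow (hG : G.IsAcyclic) (hc : 0 ≤ c)
    (hclique : Φ.IsRouteClique {p | c p ≠ 0}) {D : Set (List E)} (hD : Φ.IsPreLower D) (e : E) :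
    Φ.transport (routeFlow c) (weight c (routesVia (G.tail e) D)) e =
      weight c (routesVia (G.head e) (Φ.extendLower D e)) := by
  rw [transport, share_routeFlow hG hc hclique hD,
    sum_routeFlow_eq_weight c fun p f hf g hg hfe hge =>
      Route.eq_of_head_eq hG hf hg (hfe.head_eq.trans hge.head_eq.symm), ← weight_union]
  · congr 1
    ext p
    constructor
    · rintro (⟨f, hfp, hf⟩ | ⟨p₁, p₂, hp, hp₁⟩)
      · obtain ⟨l, m, hp⟩ := List.append_of_mem hfp
        exact ⟨l ++ [f], m, hf.head_eq ▸ Route.splitsAt_head hp, l, f, rfl, Or.inl hf⟩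
      · exact ⟨p₁ ++ [e], p₂, Route.splitsAt_head hp, p₁, e, rfl, Or.inr ⟨rfl, hp₁⟩⟩
    · rintro ⟨_, p₂, ⟨hp, -⟩, l, f, rfl, hf | ⟨rfl, hl⟩⟩
      · exact Or.inl ⟨f, by simp [hp], hf⟩
      · exact Or.inr ⟨l, p₂, by simpa using hp, hl⟩
  · refine Set.disjoint_left.2 ?_
    rintro p ⟨f, hfp, hf⟩ ⟨p₁, p₂, hp, -⟩
    obtain rfl := Route.eq_of_head_eq hG (f := e) hfp (by simp [hp]) hf.head_eq
    exact irrefl _ hf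

theorem foldl_transport_routeFlow (hG : G.IsAcyclic) (hc : 0 ≤ c)
    (hclique : Φ.IsRouteClique {p | c p ≠ 0}) {D : Set (List E)} (hD : Φ.IsPreLower D) {u v : V}
    {l : List E} (hl : G.IsPath u l v) :
    l.foldl (Φ.transport (routeFlow c)) (weight c (routesVia u D)) =
      weight c (routesVia v (l.foldl Φ.extendLower D)) := by
  induction l generalizing u D with
  | nil => rw [show u = v from hl, List.foldl_nil, List.foldl_nil]
  | cons e l ih =>
    rw [List.foldl_cons, List.foldl_cons, ← ih (hD.extendLower e) hl.2, ← hl.1,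
      transport_routeFlow hG hc hclique hD]

theorem coefficient_routeFlow (hG : G.IsAcyclic) (hGne : ∀ v, G.IsSource v → ¬ G.IsSink v)
    (hc : 0 ≤ c) (hclique : Φ.IsRouteClique {p | c p ≠ 0}) (p : G.Route) :
    Φ.coefficient (routeFlow c) p = c p := by
  have hstart : ∑ e with G.tail e = p.start, routeFlow c e = weight c (routesVia p.start {[]}) := by
    rw [routesVia_of_isSource p.isSource (hGne _ p.isSource)]
    exact sum_routeFlow_eq_weight c fun q e he f hf hes hfs =>
      Route.eq_of_tail_eq hG he hf (hes.trans hfs.symm)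
  have hzero : (0 : ℝ) = weight c (routesVia p.start ∅) := by rw [routesVia_empty, weight_empty]
  rw [coefficient, hstart, hzero,
    foldl_transport_routeFlow hG hc hclique (isPreLower_singleton_nil Φ) p.isPath,
    foldl_transport_routeFlow hG hc hclique (isPreLower_empty Φ) p.isPath,
    foldl_extendLower_singleton_nil, routesVia_union, routesVia_finish_edges hGne,
    weight_union, weight_singleton, add_sub_cancel_left]
  rw [← routesVia_finish_edges hGne]
  exact disjoint_routesVia hG _
    (Set.disjoint_singleton_right.2 (notMem_foldl_extendLower_empty p.edges))

end RouteFlow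

namespace IsRouteClique

variable {R : Set G.Route}

theorem mono {S : Set G.Route} (hR : Φ.IsRouteClique R) (h : S ⊆ R) : Φ.IsRouteClique S :=
  fun p hp q hq => hR p (h hp) q (h hq)

variable [Finite E] [Fintype G.Route]

theorem routeFlow_injOn (hG : G.IsAcyclic) (hGne : ∀ v, G.IsSource v → ¬ G.IsSink v)
    (hR : Φ.IsRouteClique R) :
    Set.InjOn (routeFlow (G := G)) {c | 0 ≤ c ∧ ∀ p, c p ≠ 0 → p ∈ R} := by
  have := Fintype.ofFinite E
  rintro c ⟨hc, hcR⟩ d ⟨hd, hdR⟩ h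
  ext p
  rw [← coefficient_routeFlow hG hGne hc (hR.mono hcR) p, h,
    coefficient_routeFlow hG hGne hd (hR.mono hdR) p]

variable {c : G.Route → ℝ}

theorem eq_zero_of_routeFlow_eq_zero (hG : G.IsAcyclic)
    (hGne : ∀ v, G.IsSource v → ¬ G.IsSink v) (hR : Φ.IsRouteClique R)
    (hcR : ∀ p, c p ≠ 0 → p ∈ R) (h : routeFlow c = 0) : c = 0 := by
  have hsub : c⁺ - c⁻ = c := posPart_sub_negPart c
  have hpos (p : G.Route) (hp : c⁺ p ≠ 0) : p ∈ R :=
    hcR p fun h => hp (by simp [Pi.posPart_apply, h])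
  have hneg (p : G.Route) (hp : c⁻ p ≠ 0) : p ∈ R :=
    hcR p fun h => hp (by simp [Pi.negPart_apply, h])
  rw [← hsub, map_sub, sub_eq_zero] at h
  rw [← hsub, hR.routeFlow_injOn hG hGne ⟨posPart_nonneg c, hpos⟩ ⟨negPart_nonneg c, hneg⟩ h,
    sub_self]

theorem isIntegerPoint_of_routeFlow (hG : G.IsAcyclic)
    (hGne : ∀ v, G.IsSource v → ¬ G.IsSink v) (hR : Φ.IsRouteClique R)
    (hcR : ∀ p, c p ≠ 0 → p ∈ R) (h : IsIntegerPoint (routeFlow c)) : IsIntegerPoint c := by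
  have := Fintype.ofFinite E
  let H : AddSubgroup ℝ := (Int.castAddHom ℝ).range
  have hfract (p : G.Route) (hp : Int.fract (c p) ≠ 0) : p ∈ R := hcR p fun h => hp (by simp [h])
  have hflow (e : E) : routeFlow (fun p => Int.fract (c p)) e ∈ H := by
    obtain ⟨n, hn⟩ := h e
    have hsub : routeFlow (fun p => Int.fract (c p)) e =
        routeFlow c e - ∑ p : G.Route, ⌊c p⌋ * p.indicator e := by
      simp only [routeFlow_apply, Int.fract, sub_mul, Finset.sum_sub_distrib]
    rw [hsub, hn]
    refine sub_mem ⟨n, rfl⟩ (sum_mem fun p _ => ?_)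
    by_cases he : e ∈ p.edges
    · exact ⟨⌊c p⌋, by simp [Route.indicator_of_mem he]⟩
    · exact ⟨0, by simp [Route.indicator_of_notMem he]⟩
  intro p
  obtain ⟨n, hn⟩ := coefficient_mem Φ hflow p
  rw [coefficient_routeFlow hG hGne (fun p => Int.fract_nonneg (c p)) (hR.mono hfract)] at hn
  exact ⟨⌊c p⌋ + n, by rw [Int.cast_add, show (n : ℝ) = _ from hn, Int.floor_add_fract]⟩

end IsRouteClique

end Framing

/-! ### Layerings -/

theorem IsConservationist.not_isSink {a : V → ℤ} (ha : G.IsConservationist a) (v : V)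
    (hv : G.IsSource v) : ¬ G.IsSink v := fun hv' => by
  have := ha.source v hv
  have := ha.sink v hv'
  lia

theorem IsPath.finish_unique_of_start {u v v' : V} {l : List E} (h : G.IsPath u l v)
    (h' : G.IsPath u l v') : v = v' := by
  induction l generalizing u with
  | nil => exact (show u = v from h).symm.trans h'
  | cons e l ih => exact ih h.2 h'.2

theorem Route.ext_start_edges {p q : G.Route} (hs : p.start = q.start) (h : p.edges = q.edges) :
    p = q :=
  Route.ext hs h ((h ▸ hs ▸ p.isPath).finish_unique_of_start q.isPath)

/-- The starting point of a route, as an element of the type of sources. -/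
def Route.source (p : G.Route) : {v : V // G.IsSource v} := ⟨p.start, p.isSource⟩

/-- The endpoint of a route, as an element of the type of sinks. -/
def Route.sink (p : G.Route) : {v : V // G.IsSink v} := ⟨p.finish, p.isSink⟩

theorem Route.source_eq_iff {p : G.Route} {s : {v : V // G.IsSource v}} :
    p.source = s ↔ p.start = s := Subtype.ext_iff

theorem Route.sink_eq_iff {p : G.Route} {j : {v : V // G.IsSink v}} :
    p.sink = j ↔ p.finish = j := Subtype.ext_iff

variable {a : V → ℤ}

namespace Layering

variable {L M : G.Layering a}

theorem routeFrom_mem (L : G.Layering a) (s : {v : V // G.IsSource v}) : L.routeFrom s ∈ L.routes :=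
  (L.existsUnique_start s s.2).choose_spec.1.1

theorem start_routeFrom (L : G.Layering a) (s : {v : V // G.IsSource v}) :
    (L.routeFrom s).start = s :=
  (L.existsUnique_start s s.2).choose_spec.1.2

theorem mem_routes_iff {p : G.Route} : p ∈ L.routes ↔ L.routeFrom p.source = p :=
  ⟨fun hp => ((L.existsUnique_start p.start p.isSource).choose_spec.2 p ⟨hp, rfl⟩).symm,
    fun h => h ▸ L.routeFrom_mem _⟩

theorem ext_routeFrom (h : ∀ s, L.routeFrom s = M.routeFrom s) : L = M :=
  Layering.ext <| Finset.ext fun p => by rw [mem_routes_iff, mem_routes_iff, h]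

instance [Finite G.Route] : Finite (G.Layering a) :=
  Finite.of_injective (fun L : G.Layering a => L.routes) fun _ _ => Layering.ext

/-- The `0`-`1` vector of the set of routes of a layering. -/
def routeVector (L : G.Layering a) : G.Route → ℝ := fun p => if p ∈ L.routes then 1 else 0

theorem routeVector_nonneg (L : G.Layering a) : 0 ≤ L.routeVector := fun p => by
  unfold routeVector
  positivity

theorem routeFlow_routeVector [Fintype G.Route] (L : G.Layering a) :
    routeFlow L.routeVector = L.indicator := by
  simp [routeFlow, Fintype.linearCombination_apply, routeVector, indicator, ite_smul]

end Layering

theorem Layering.exists_of_equiv [Finite V] {p : {v : V // G.IsSource v} → G.Route}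
    (hp : ∀ s, (p s).start = s)
    (f : {v : V // G.IsSource v} ≃ Σ j : {v : V // G.IsSink v}, Fin (a j).natAbs)
    (hf : ∀ s, (p s).sink = (f s).1) : ∃ L : G.Layering a, ∀ q ∈ L.routes, ∃ s, p s = q := by
  have hinj : Function.Injective p := fun s s' h => Subtype.ext (by rw [← hp, h, hp])
  have hcard (j : {v : V // G.IsSink v}) :
      {q ∈ Set.range p | q.finish = j}.ncard = (a j).natAbs := by
    have hset : {q ∈ Set.range p | q.finish = j} = Set.range fun k => p (f.symm ⟨j, k⟩) := by
      ext q
      constructor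
      · rintro ⟨⟨s, rfl⟩, hs⟩
        obtain rfl : (f s).1 = j := (hf s).symm.trans (Route.sink_eq_iff.2 hs)
        exact ⟨(f s).2, by simp⟩
      · rintro ⟨k, rfl⟩
        exact ⟨⟨_, rfl⟩, Route.sink_eq_iff.1 (by rw [hf, Equiv.apply_symm_apply])⟩
    rw [hset, Set.ncard_range_of_injective, Nat.card_fin]
    exact hinj.comp (f.symm.injective.comp sigma_mk_injective)
  refine ⟨⟨(Set.finite_range p).toFinset, fun s hs => ⟨p ⟨s, hs⟩, ⟨by simp, hp _⟩, ?_⟩,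
    fun j hj => ?_⟩, by simp⟩
  · rintro _ ⟨hq, hqs⟩
    obtain ⟨s', rfl⟩ : ∃ s', p s' = _ := by simpa using hq
    exact congrArg p (Subtype.ext ((hp s').symm.trans hqs))
  · rw [Set.Finite.coe_toFinset, hcard ⟨j, hj⟩, Int.natCast_natAbs]

/-- The weight `c` on the routes is balanced with total `x` if routes of total weight `x` start at
every source and routes of total weight `x * |a j|` end at every sink `j`; a layering is thus a set
of routes whose `0`-`1` vector is balanced with total `1`. -/
structure IsBalanced [Fintype G.Route] (a : V → ℤ) (c : G.Route → ℝ) (x : ℝ) : Prop where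
  sum_start : ∀ s, G.IsSource s → ∑ p with p.start = s, c p = x
  sum_finish : ∀ j, G.IsSink j → ∑ p with p.finish = j, c p = x * |a j|

section Balanced

variable [Fintype G.Route] {c : G.Route → ℝ} {x : ℝ}

theorem Layering.isBalanced_routeVector (L : G.Layering a) : IsBalanced a L.routeVector 1 := by
  refine ⟨fun s hs => ?_, fun j hj => ?_⟩
  · rw [Finset.sum_eq_single_of_mem (L.routeFrom ⟨s, hs⟩) (by simp [L.start_routeFrom]),
      routeVector, if_pos (L.routeFrom_mem _)]
    simp only [Finset.mem_filter_univ, routeVector, ite_eq_right_iff, one_ne_zero, imp_false]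
    rintro p rfl hne hp
    exact hne (mem_routes_iff.1 hp).symm
  · have hset : {p ∈ (L.routes : Set G.Route) | p.finish = j} =
        ((Finset.univ.filter fun p : G.Route => p.finish = j ∧ p ∈ L.routes : Finset G.Route) :
          Set G.Route) := by
      ext p
      simp [and_comm]
    have hcard := L.card_finish j hj
    rw [hset, Set.ncard_coe_finset] at hcard
    simp only [routeVector, Finset.sum_boole, Finset.filter_filter, one_mul]
    exact_mod_cast hcard

theorem IsBalanced.sub_smul {d : G.Route → ℝ} (hc : IsBalanced a c x) (hd : IsBalanced a d 1)
    (y : ℝ) : IsBalanced a (c - y • d) (x - y) := by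
  refine ⟨fun s hs => ?_, fun j hj => ?_⟩
  · simp [← Finset.mul_sum, hc.sum_start s hs, hd.sum_start s hs]
  · simp [← Finset.mul_sum, hc.sum_finish j hj, hd.sum_finish j hj, sub_mul]

theorem IsBalanced.mul_card_eq (hc : IsBalanced a c x) (A : Finset {v : V // G.IsSource v}) :
    x * #A = ∑ p with Route.source p ∈ A, c p := by
  simp_rw [← Finset.sum_fiberwise_eq_sum_filter, Route.source_eq_iff,
    hc.sum_start _ (Subtype.prop _)]
  rw [Finset.sum_const, nsmul_eq_mul, mul_comm]

theorem IsBalanced.mul_sum_natAbs_eq (hc : IsBalanced a c x) (B : Finset {v : V // G.IsSink v}) :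
    x * (∑ j ∈ B, (a j).natAbs : ℕ) = ∑ p with Route.sink p ∈ B, c p := by
  simp_rw [← Finset.sum_fiberwise_eq_sum_filter, Route.sink_eq_iff,
    hc.sum_finish _ (Subtype.prop _)]
  rw [← Finset.mul_sum, Nat.cast_sum]
  simp only [Nat.cast_natAbs]

theorem IsBalanced.card_le (hc : IsBalanced a c x) (hx : 0 < x) (h0 : 0 ≤ c)
    {A : Finset {v : V // G.IsSource v}} {B : Finset {v : V // G.IsSink v}}
    (hAB : ∀ p : G.Route, c p ≠ 0 → p.source ∈ A → p.sink ∈ B) :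
    #A ≤ ∑ j ∈ B, (a j).natAbs := by
  have hle : x * #A ≤ x * (∑ j ∈ B, (a j).natAbs : ℕ) := by
    rw [hc.mul_card_eq, hc.mul_sum_natAbs_eq, ← Finset.sum_filter_ne_zero]
    refine Finset.sum_le_sum_of_subset_of_nonneg (fun p hp => ?_) fun p _ _ => h0 p
    simp only [Finset.mem_filter, Finset.mem_univ, true_and] at hp ⊢
    exact hAB p hp.2 hp.1
  exact_mod_cast le_of_mul_le_mul_left hle hx

theorem IsBalanced.card_sources [Fintype V] (hc : IsBalanced a c x) (hx : x ≠ 0) :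
    Fintype.card {v : V // G.IsSource v} = ∑ j : {v : V // G.IsSink v}, (a j).natAbs := by
  have h := (hc.mul_card_eq Finset.univ).trans
    (Eq.trans (by simp) (hc.mul_sum_natAbs_eq Finset.univ).symm)
  exact_mod_cast mul_left_cancel₀ hx h

theorem IsBalanced.exists_layering [Finite V] (hc : IsBalanced a c x) (hx : 0 < x) (h0 : 0 ≤ c) :
    ∃ L : G.Layering a, ∀ p ∈ L.routes, c p ≠ 0 := by
  have := Fintype.ofFinite V
  let slots (s : {v : V // G.IsSource v}) :
      Finset (Σ j : {v : V // G.IsSink v}, Fin (a j).natAbs) :=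
    {k | ∃ p : G.Route, c p ≠ 0 ∧ p.source = s ∧ p.sink = k.1}
  have hall (A : Finset {v : V // G.IsSource v}) : #A ≤ #(A.biUnion slots) := by
    let B : Finset {v : V // G.IsSink v} := {j | ∃ p : G.Route, c p ≠ 0 ∧ p.source ∈ A ∧ p.sink = j}
    have hslots : A.biUnion slots = B.sigma fun _ => Finset.univ := by
      ext k
      simp only [slots, B, Finset.mem_biUnion, Finset.mem_sigma, Finset.mem_filter_univ,
        Finset.mem_univ, and_true]
      exact ⟨fun ⟨_, hs, p, hp, h, h'⟩ => ⟨p, hp, h ▸ hs, h'⟩, fun ⟨p, hp, h, h'⟩ =>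
        ⟨_, h, p, hp, rfl, h'⟩⟩
    rw [hslots, Finset.card_sigma]
    simpa using hc.card_le hx h0 fun p hp hpA => by simpa [B] using ⟨p, hp, hpA, rfl⟩
  obtain ⟨f, hf, hslot⟩ := (Finset.all_card_le_biUnion_card_iff_exists_injective slots).1 hall
  have hbij : Function.Bijective f := by
    rw [Fintype.bijective_iff_injective_and_card, hc.card_sources hx.ne']
    exact ⟨hf, by simp⟩
  choose p hpc hpsource hpsink using fun s => (Finset.mem_filter.1 (hslot s)).2
  obtain ⟨L, hL⟩ := Layering.exists_of_equiv (fun s => Route.source_eq_iff.1 (hpsource s))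
    (Equiv.ofBijective f hbij) hpsink
  refine ⟨L, fun q hq => ?_⟩
  obtain ⟨s, rfl⟩ := hL q hq
  exact hpc s

end Balanced

/-! ### Layering-simplices -/

namespace Framing

variable {Φ : G.Framing}

theorem layeringLT_trichotomous [Finite V] {L M : G.Layering a} (hLM : ¬ Φ.LayeringLT L M)
    (hML : ¬ Φ.LayeringLT M L) : L = M := by
  let := Φ.srcOrder
  refine Layering.ext_routeFrom fun s => ?_
  induction s using WellFoundedGT.induction with
  | ind s ih =>
  have hL : G.IsPath s (L.routeFrom s).edges _ := L.start_routeFrom s ▸ (L.routeFrom s).isPath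
  have hM : G.IsPath s (M.routeFrom s).edges _ := M.start_routeFrom s ▸ (M.routeFrom s).isPath
  rcases postLT_trichotomous hL hM (L.routeFrom s).isSink (M.routeFrom s).isSink with h | h | h
  · exact absurd ⟨s, h, ih⟩ hLM
  · exact Route.ext_start_edges (by rw [L.start_routeFrom, M.start_routeFrom]) h
  · exact absurd ⟨s, h, fun t ht => (ih t ht).symm⟩ hML

theorem LayeringLT.trans {L M N : G.Layering a} (hLM : Φ.LayeringLT L M)
    (hMN : Φ.LayeringLT M N) : Φ.LayeringLT L N := by
  let := Φ.srcOrder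
  obtain ⟨s, h, hs⟩ := hLM
  obtain ⟨s', h', hs'⟩ := hMN
  rcases lt_trichotomy s s' with hlt | rfl | hlt
  · exact ⟨s', hs s' hlt ▸ h', fun t ht => (hs t (hlt.trans ht)).trans (hs' t ht)⟩
  · exact ⟨s, h.trans h', fun t ht => (hs t ht).trans (hs' t ht)⟩
  · exact ⟨s, hs' s hlt ▸ h, fun t ht => (hs t ht).trans (hs' t (hlt.trans ht))⟩

instance [Finite V] : IsStrictTotalOrder (G.Layering a) Φ.LayeringLT where
  irrefl := fun _ ⟨_, h, _⟩ => postLT_irrefl _ h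
  trans _ _ _ := LayeringLT.trans
  trichotomous _ _ := layeringLT_trichotomous

end Framing

/-- The weights `∑ L ∋ p, y L` that a combination of layerings with coefficients `y` puts on the
routes `p`. -/
def routeWeight [Fintype (G.Layering a)] : (G.Layering a → ℝ) →ₗ[ℝ] (G.Route → ℝ) :=
  Fintype.linearCombination ℝ Layering.routeVector

section RouteWeight

variable [Fintype (G.Layering a)] {y y' : G.Layering a → ℝ}

theorem routeWeight_apply (y : G.Layering a → ℝ) (p : G.Route) :
    routeWeight y p = ∑ L with p ∈ L.routes, y L := by
  simp [routeWeight, Fintype.linearCombination_apply, Layering.routeVector, Finset.sum_filter]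

theorem routeWeight_single (L : G.Layering a) (x : ℝ) :
    routeWeight (Pi.single L x) = x • L.routeVector := by
  simp [routeWeight, Fintype.linearCombination_apply_single]

theorem routeWeight_nonneg (hy : 0 ≤ y) : 0 ≤ routeWeight y := fun p => by
  rw [routeWeight_apply]
  exact Finset.sum_nonneg fun L _ => hy L

theorem mem_routesOf_of_routeWeight_ne_zero {K : Set (G.Layering a)} (hyK : ∀ L, y L ≠ 0 → L ∈ K)
    {p : G.Route} (hp : routeWeight y p ≠ 0) : p ∈ routesOf K := by
  rw [routeWeight_apply] at hp
  obtain ⟨L, hL, hne⟩ := Finset.exists_ne_zero_of_sum_ne_zero hp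
  exact ⟨L, hyK L hne, (Finset.mem_filter.1 hL).2⟩

theorem routeFlow_routeWeight [Fintype G.Route] (y : G.Layering a → ℝ) :
    routeFlow (routeWeight y) = ∑ L, y L • L.indicator := by
  simp [routeWeight, Fintype.linearCombination_apply, Layering.routeFlow_routeVector]

namespace Framing

variable {Φ : G.Framing} {L : G.Layering a} {K K' : Finset (G.Layering a)}

theorem routeWeight_eq_sum_lt_add (Φ : G.Framing) (L : G.Layering a) (y : G.Layering a → ℝ)
    (p : G.Route) :
    routeWeight y p = ∑ N with p ∈ N.routes ∧ Φ.LayeringLT N L, y N +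
      ∑ N with p ∈ N.routes ∧ ¬ Φ.LayeringLT N L, y N := by
  simp_rw [routeWeight_apply, ← Finset.filter_filter, Finset.sum_filter_add_sum_filter_not]

theorem sum_not_lt_eq_of_routeWeight_eq (h : routeWeight y = routeWeight y')
    (hlt : ∀ N, Φ.LayeringLT N L → y N = y' N) (p : G.Route) :
    ∑ N with p ∈ N.routes ∧ ¬ Φ.LayeringLT N L, y N =
      ∑ N with p ∈ N.routes ∧ ¬ Φ.LayeringLT N L, y' N := by
  have hp := congrFun h p
  rwa [routeWeight_eq_sum_lt_add Φ L, routeWeight_eq_sum_lt_add Φ L,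
    Finset.sum_congr rfl fun N hN => hlt N (Finset.mem_filter.1 hN).2.2, add_right_inj] at hp

variable [Finite V]

theorem le_sum_not_lt (hy : 0 ≤ y) {p : G.Route} (hp : p ∈ L.routes) :
    y L ≤ ∑ N with p ∈ N.routes ∧ ¬ Φ.LayeringLT N L, y N :=
  Finset.single_le_sum (f := y) (fun N _ => hy N) (by simpa using ⟨hp, _root_.irrefl L⟩)

namespace IsLayeringSimplex

theorem exists_sum_not_lt_eq (hK : Φ.IsLayeringSimplex K) (hyK : ∀ L, y L ≠ 0 → L ∈ K)
    (hL : L ∈ K) :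
    ∃ p ∈ L.routes, ∑ N with p ∈ N.routes ∧ ¬ Φ.LayeringLT N L, y N = y L := by
  obtain ⟨p, hp, hnew⟩ := hK.new_route L hL
  refine ⟨p, hp, Finset.sum_eq_single_of_mem L (by simpa using ⟨hp, _root_.irrefl L⟩)
    fun N hN hNL => ?_⟩
  obtain ⟨hpN, hlt⟩ := (Finset.mem_filter.1 hN).2
  by_contra hyN
  exact hnew ⟨N, ⟨hyK N hyN, (trichotomous_of Φ.LayeringLT L N).resolve_right
    (not_or.2 ⟨hNL.symm, hlt⟩)⟩, hpN⟩

theorem coeff_mem (hK : Φ.IsLayeringSimplex K) (hyK : ∀ L, y L ≠ 0 → L ∈ K) {H : AddSubgroup ℝ}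
    (hH : ∀ p, routeWeight y p ∈ H) (L : G.Layering a) : y L ∈ H := by
  let := linearOrderOfSTO (Φ.LayeringLT (a := a))
  induction L using WellFoundedLT.induction with
  | ind L ih =>
  by_cases hyL : y L = 0
  · exact hyL ▸ H.zero_mem
  obtain ⟨p, -, hp⟩ := hK.exists_sum_not_lt_eq hyK (hyK L hyL)
  have hmem := hH p
  rw [routeWeight_eq_sum_lt_add Φ L, hp] at hmem
  exact (H.add_mem_cancel_left (H.sum_mem fun N hN => ih N (Finset.mem_filter.1 hN).2.2)).1 hmem

theorem ne_zero_of_routeWeight_eq (hK : Φ.IsLayeringSimplex K) (hyK : ∀ L, y L ≠ 0 → L ∈ K)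
    (hy' : 0 ≤ y') (h : routeWeight y = routeWeight y')
    (hlt : ∀ N, Φ.LayeringLT N L → y N = y' N) (hne : L.routes.Nonempty) (hL : y' L ≠ 0) :
    y L ≠ 0 := by
  let := linearOrderOfSTO (Φ.LayeringLT (a := a))
  have hcover (p : G.Route) (hp : p ∈ L.routes) : ∃ N, p ∈ N.routes ∧ L ≤ N ∧ y N ≠ 0 := by
    have hpos := ((hy' L).lt_of_ne' hL).trans_le (le_sum_not_lt (Φ := Φ) hy' hp)
    rw [← sum_not_lt_eq_of_routeWeight_eq h hlt] at hpos
    obtain ⟨N, hN, hyN⟩ := Finset.exists_ne_zero_of_sum_ne_zero hpos.ne'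
    exact ⟨N, (Finset.mem_filter.1 hN).2.1, not_lt.1 (Finset.mem_filter.1 hN).2.2, hyN⟩
  obtain ⟨p, hp⟩ := hne
  obtain ⟨N, -, hLN, hyN⟩ := hcover p hp
  obtain ⟨M, ⟨hLM, hyM⟩, hmin⟩ :=
    (Set.toFinite {N | L ≤ N ∧ y N ≠ 0}).exists_minimal ⟨N, hLN, hyN⟩
  have hML : M ≤ L := le_iff_eq_or_lt.2 <| hK.minimal M (hyK M hyM) L fun p hp => by
    obtain ⟨N, hpN, hLN, hyN⟩ := hcover p hp
    refine ⟨N, ⟨hyK N hyN, le_iff_eq_or_lt.1 ?_⟩, hpN⟩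
    exact (le_total M N).elim id fun h => hmin ⟨hLN, hyN⟩ h
  exact le_antisymm hML hLM ▸ hyM

theorem le_of_routeWeight_eq (hK : Φ.IsLayeringSimplex K) (hK' : Φ.IsLayeringSimplex K')
    (hyK : ∀ L, y L ≠ 0 → L ∈ K) (hyK' : ∀ L, y' L ≠ 0 → L ∈ K') (hy : 0 ≤ y) (hy' : 0 ≤ y')
    (h : routeWeight y = routeWeight y')
    (hlt : ∀ N, Φ.LayeringLT N L → y N = y' N) : y' L ≤ y L := by
  by_cases hL : y' L = 0
  · exact hL.trans_le (hy L)
  have hne : L.routes.Nonempty := (hK'.new_route L (hyK' L hL)).imp fun _ => And.left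
  have hL' := hK.ne_zero_of_routeWeight_eq hyK hy' h hlt hne hL
  obtain ⟨p, hp, hsum⟩ := hK.exists_sum_not_lt_eq hyK (hyK L hL')
  rw [← hsum, sum_not_lt_eq_of_routeWeight_eq h hlt]
  exact le_sum_not_lt hy' hp

theorem eq_of_routeWeight_eq (hK : Φ.IsLayeringSimplex K) (hK' : Φ.IsLayeringSimplex K')
    (hyK : ∀ L, y L ≠ 0 → L ∈ K) (hyK' : ∀ L, y' L ≠ 0 → L ∈ K') (hy : 0 ≤ y) (hy' : 0 ≤ y')
    (h : routeWeight y = routeWeight y') : y = y' := by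
  let := linearOrderOfSTO (Φ.LayeringLT (a := a))
  funext L
  induction L using WellFoundedLT.induction with
  | ind L ih =>
  exact le_antisymm (hK'.le_of_routeWeight_eq hK hyK' hyK hy' hy h.symm fun N hN => (ih N hN).symm)
    (hK.le_of_routeWeight_eq hK' hyK hyK' hy hy' h ih)

end IsLayeringSimplex

end Framing

end RouteWeight

theorem routesOf_insert_subset {K : Finset (G.Layering a)} {L : G.Layering a} {R : Set G.Route}
    (hK : routesOf (K : Set (G.Layering a)) ⊆ R) (hL : ∀ p ∈ L.routes, p ∈ R) :
    routesOf ((insert L K : Finset (G.Layering a)) : Set (G.Layering a)) ⊆ R := by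
  rintro p ⟨N, hN, hp⟩
  rcases Finset.mem_insert.1 hN with rfl | hN
  · exact hL p hp
  · exact hK ⟨N, hN, hp⟩

namespace Framing.IsLayeringSimplex

variable {Φ : G.Framing} {K K' : Finset (G.Layering a)} {L : G.Layering a}

theorem mono (hK : Φ.IsLayeringSimplex K) (h : K' ⊆ K) : Φ.IsLayeringSimplex K' where
  clique := hK.clique.mono fun _ ⟨L, hL, hp⟩ => ⟨L, h hL, hp⟩
  minimal L hL M hM := hK.minimal L (h hL) M fun p hp =>
    let ⟨N, ⟨hN, hLN⟩, hpN⟩ := hM p hp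
    ⟨N, ⟨h hN, hLN⟩, hpN⟩
  new_route L hL :=
    let ⟨p, hp, hnew⟩ := hK.new_route L (h hL)
    ⟨p, hp, fun ⟨N, ⟨hN, hLN⟩, hpN⟩ => hnew ⟨N, ⟨h hN, hLN⟩, hpN⟩⟩

theorem insert [Finite V] (hK : Φ.IsLayeringSimplex K) {R : Set G.Route} (hR : Φ.IsRouteClique R)
    (hKR : routesOf (K : Set (G.Layering a)) ⊆ R) (hLR : ∀ p ∈ L.routes, p ∈ R)
    (hmin : ∀ M : G.Layering a, (∀ p ∈ M.routes, p ∈ R) → L = M ∨ Φ.LayeringLT L M)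
    (hnew : ∃ p ∈ L.routes, p ∉ routesOf (K : Set (G.Layering a))) :
    Φ.IsLayeringSimplex (insert L K) := by
  obtain ⟨q, hq, hqK⟩ := hnew
  have hlt (N : G.Layering a) (hN : N ∈ K) : Φ.LayeringLT L N :=
    (hmin N fun p hp => hKR ⟨N, hN, hp⟩).resolve_left fun h => hqK ⟨N, hN, h ▸ hq⟩
  have hsub := routesOf_insert_subset hKR hLR
  have hmem {N N' : G.Layering a} (hN : N ∈ K) (hN' : N' ∈ Insert.insert L K)
      (h : N = N' ∨ Φ.LayeringLT N N') : N' ∈ K := by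
    rcases Finset.mem_insert.1 hN' with rfl | hN'
    · rcases h with rfl | h
      · exact hN
      · exact absurd ((hlt N hN).trans h) (_root_.irrefl _)
    · exact hN'
  refine ⟨hR.mono hsub, fun N hN M hM => ?_, fun N hN => ?_⟩ <;>
    rcases Finset.mem_insert.1 hN with rfl | hNK
  · exact hmin M fun p hp => let ⟨N', hN', hpN'⟩ := hM p hp; hsub ⟨N', hN'.1, hpN'⟩
  · exact hK.minimal N hNK M fun p hp =>
      let ⟨N', hN', hpN'⟩ := hM p hp; ⟨N', ⟨hmem hNK hN'.1 hN'.2, hN'.2⟩, hpN'⟩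
  · refine ⟨q, hq, fun ⟨N', hN', hqN'⟩ => hqK ⟨N', ?_, hqN'⟩⟩
    exact (Finset.mem_insert.1 hN'.1).resolve_left fun h =>
      _root_.irrefl N (show Φ.LayeringLT N N from h ▸ hN'.2)
  · obtain ⟨p, hp, hnew⟩ := hK.new_route N hNK
    exact ⟨p, hp, fun ⟨N', hN', hpN'⟩ =>
      hnew ⟨N', ⟨hmem hNK hN'.1 (Or.inr hN'.2), hN'.2⟩, hpN'⟩⟩

end Framing.IsLayeringSimplex

namespace IsBalanced

variable [Fintype G.Route] {c : G.Route → ℝ} {x : ℝ}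

theorem pos (hc : IsBalanced a c x) (h0 : 0 ≤ c) {p : G.Route} (hp : c p ≠ 0) : 0 < x := by
  rw [← hc.sum_start _ p.isSource]
  exact Finset.sum_pos' (fun q _ => h0 q) ⟨p, by simp, (h0 p).lt_of_ne' hp⟩

theorem exists_minimal_layering [Finite V] (hc : IsBalanced a c x) (hx : 0 < x) (h0 : 0 ≤ c)
    (Φ : G.Framing) : ∃ L : G.Layering a, (∀ p ∈ L.routes, c p ≠ 0) ∧
      ∀ M : G.Layering a, (∀ p ∈ M.routes, c p ≠ 0) → L = M ∨ Φ.LayeringLT L M := by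
  let := linearOrderOfSTO (Φ.LayeringLT (a := a))
  obtain ⟨L, hL, hmin⟩ := (Set.toFinite
    {L : G.Layering a | ∀ p ∈ L.routes, c p ≠ 0}).exists_minimal (hc.exists_layering hx h0)
  exact ⟨L, hL, fun M hM => le_iff_eq_or_lt.1 <| (le_total L M).elim id fun h => hmin hM h⟩

end IsBalanced

theorem Layering.exists_sub_smul_nonneg {c : G.Route → ℝ} (h0 : 0 ≤ c) {L : G.Layering a}
    (hL : ∀ p ∈ L.routes, c p ≠ 0) (hne : L.routes.Nonempty) :
    ∃ q ∈ L.routes, 0 ≤ c - c q • L.routeVector ∧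
      ∀ p, (c - c q • L.routeVector) p ≠ 0 → c p ≠ 0 := by
  obtain ⟨q, hq, hmin⟩ := L.routes.exists_min_image c hne
  refine ⟨q, hq, fun p => ?_, fun p hp => ?_⟩ <;> by_cases hpL : p ∈ L.routes
  · simpa [routeVector, hpL] using hmin p hpL
  · simpa [routeVector, hpL] using h0 p
  · exact hL p hpL
  · simpa [routeVector, hpL] using hp

/-- The greedy decomposition subtracts the smallest layering in the support of `c` with the largest
possible coefficient, which removes one of its routes from the support. -/
theorem IsBalanced.exists_layeringSimplex [Finite V] [Fintype G.Route] [Fintype (G.Layering a)]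
    {Φ : G.Framing} {c : G.Route → ℝ} {x : ℝ} (hc : IsBalanced a c x) (h0 : 0 ≤ c)
    (hclique : Φ.IsRouteClique {p | c p ≠ 0}) :
    ∃ (K : Finset (G.Layering a)) (y : G.Layering a → ℝ), Φ.IsLayeringSimplex K ∧
      routesOf (K : Set (G.Layering a)) ⊆ {p | c p ≠ 0} ∧
      0 ≤ y ∧ (∀ L, y L ≠ 0 → L ∈ K) ∧ routeWeight y = c := by
  induction hn : #{p | c p ≠ 0} using Nat.strong_induction_on generalizing c x with
  | h n ih =>
  by_cases hzero : c = 0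
  · refine ⟨∅, 0, ⟨?_, by simp, by simp⟩, ?_, le_rfl, by simp, by simp [hzero]⟩
    all_goals simp [routesOf, Framing.IsRouteClique]
  obtain ⟨p, hp⟩ := Function.ne_iff.1 hzero
  obtain ⟨L, hL, hmin⟩ := hc.exists_minimal_layering (hc.pos h0 hp) h0 Φ
  obtain ⟨q, hq, h0', hsupp⟩ :=
    L.exists_sub_smul_nonneg h0 hL ⟨_, L.routeFrom_mem p.source⟩
  have hq0 : (c - c q • L.routeVector) q = 0 := by simp [Layering.routeVector, hq]
  have hcard : #{p | (c - c q • L.routeVector) p ≠ 0} < n := hn ▸ Finset.card_lt_card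
    ⟨Finset.monotone_filter_right _ fun p _ => hsupp p, fun h =>
      (Finset.mem_filter.1 (h ((Finset.mem_filter_univ q).2 (hL q hq)))).2 hq0⟩
  obtain ⟨K, y, hK, hKc, hy, hyK, hcy⟩ := ih _ hcard (hc.sub_smul L.isBalanced_routeVector (c q))
    h0' (hclique.mono hsupp) rfl
  have hqK : q ∉ routesOf (K : Set (G.Layering a)) := fun h => hKc h hq0
  refine ⟨insert L K, y + Pi.single L (c q), hK.insert hclique (fun p hp => hsupp p (hKc hp)) hL
    hmin ⟨q, hq, hqK⟩, routesOf_insert_subset (fun p hp => hsupp p (hKc hp)) hL, ?_, ?_, ?_⟩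
  · exact add_nonneg hy (Pi.single_nonneg.2 (h0 q))
  · intro N hN
    by_cases hNL : N = L
    · simp [hNL]
    · exact Finset.mem_insert_of_mem (hyK N (by simpa [hNL] using hN))
  · rw [map_add, hcy, routeWeight_single, sub_add_cancel]

/-! ### The triangulation of the flow polytope -/

theorem IsAcyclic.exists_isSource [Finite V] [Nonempty V] (hG : G.IsAcyclic) :
    ∃ s, G.IsSource s := by
  obtain ⟨t, ht⟩ := hG.exists_height
  obtain ⟨s, hs⟩ := Finite.exists_min t
  exact ⟨s, fun e he => (he ▸ ht e).not_ge (hs _)⟩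

theorem Layering.isIntegerPoint_indicator (L : G.Layering a) : IsIntegerPoint L.indicator :=
  fun e => ⟨#{p ∈ L.routes | e ∈ p.edges}, by simp [indicator, Route.indicator]⟩

section FlowPolytope

variable [Fintype E]

theorem mem_flowPolytope {F : E → ℝ} :
    F ∈ G.flowPolytope a ↔ 0 ≤ F ∧ ∀ v, G.netflow v F = a v := by
  simp only [flowPolytope, netflow_apply, Set.mem_ofPred_eq, Pi.le_def, Pi.zero_apply]

theorem convex_flowPolytope : Convex ℝ (G.flowPolytope a) := by
  have h : G.flowPolytope a = Set.Ici 0 ∩ ⋂ v, {F | G.netflow v F = a v} := by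
    ext F
    simp only [mem_flowPolytope, Set.mem_inter_iff, Set.mem_Ici, Set.mem_iInter, Set.mem_ofPred_eq]
  rw [h]
  exact (convex_Ici 0).inter
    (convex_iInter fun v => convex_hyperplane (G.netflow v).isLinear (a v))

theorem IsConservationist.isFlow (ha : G.IsConservationist a) {F : E → ℝ}
    (hF : F ∈ G.flowPolytope a) : G.IsFlow F where
  nonneg := hF.1
  conserved v hv := by rw [(mem_flowPolytope.1 hF).2, ha.internal v hv, Int.cast_zero]

theorem routeFlow_mem_flowPolytope_iff [Fintype G.Route] (hG : G.IsAcyclic)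
    (ha : G.IsConservationist a) {c : G.Route → ℝ} (hc : 0 ≤ c) :
    routeFlow c ∈ G.flowPolytope a ↔ IsBalanced a c 1 := by
  have hstart (v : V) (hv : ¬ G.IsSource v) (p : G.Route) : p.start ≠ v :=
    fun h => hv (h ▸ p.isSource)
  have hfinish (v : V) (hv : ¬ G.IsSink v) (p : G.Route) : p.finish ≠ v :=
    fun h => hv (h ▸ p.isSink)
  have hsource (v : V) (hv : G.IsSource v) :
      G.netflow v (routeFlow c) = a v ↔ ∑ p with p.start = v, c p = 1 := by
    simp [netflow_routeFlow hG, ha.source v hv, hfinish v (ha.not_isSink v hv)]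
  have hsink (v : V) (hv : G.IsSink v) :
      G.netflow v (routeFlow c) = a v ↔ ∑ p with p.finish = v, c p = 1 * |a v| := by
    simp [netflow_routeFlow hG, abs_of_neg (ha.sink v hv),
      hstart v fun h => ha.not_isSink v h hv, neg_eq_iff_eq_neg]
  rw [mem_flowPolytope, and_iff_right (routeFlow_nonneg hc)]
  refine ⟨fun h => ⟨fun s hs => (hsource s hs).1 (h s), fun j hj => (hsink j hj).1 (h j)⟩,
    fun h v => ?_⟩
  by_cases hs : G.IsSource v
  · exact (hsource v hs).2 (h.sum_start v hs)
  by_cases hj : G.IsSink v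
  · exact (hsink v hj).2 (h.sum_finish v hj)
  simp [netflow_routeFlow hG, hstart v hs, hfinish v hj, ha.internal v ⟨hs, hj⟩]

theorem Layering.indicator_mem_flowPolytope [Finite G.Route] (hG : G.IsAcyclic)
    (ha : G.IsConservationist a) (L : G.Layering a) : L.indicator ∈ G.flowPolytope a := by
  have := Fintype.ofFinite G.Route
  rw [← L.routeFlow_routeVector, routeFlow_mem_flowPolytope_iff hG ha L.routeVector_nonneg]
  exact L.isBalanced_routeVector

theorem sum_eq_one_of_mem_flowPolytope [Finite V] [Nonempty V] (hG : G.IsAcyclic)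
    (ha : G.IsConservationist a) {K : Finset (G.Layering a)} {c : G.Layering a → ℝ}
    (h : ∑ L ∈ K, c L • L.indicator ∈ G.flowPolytope a) : ∑ L ∈ K, c L = 1 := by
  have := Route.finite hG
  obtain ⟨s, hs⟩ := hG.exists_isSource
  simpa [ha.source s hs, (mem_flowPolytope.1 (Layering.indicator_mem_flowPolytope hG ha _)).2]
    using (mem_flowPolytope.1 h).2 s

variable {K K' : Finset (G.Layering a)}

theorem polyhedralSimplex_eq_convexHull [Finite V] [Nonempty V] (hG : G.IsAcyclic)
    (ha : G.IsConservationist a) (K : Finset (G.Layering a)) :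
    polyhedralSimplex K = convexHull ℝ (Layering.indicator '' (K : Set (G.Layering a))) := by
  have := Route.finite hG
  refine subset_antisymm ?_ (convexHull_min ?_ ?_)
  · rintro _ ⟨hF, c, hc, rfl⟩
    exact (convex_convexHull ℝ _).sum_mem hc (sum_eq_one_of_mem_flowPolytope hG ha hF)
      fun L hL => subset_convexHull ℝ _ ⟨L, hL, rfl⟩
  · rintro _ ⟨L, hL, rfl⟩
    refine ⟨L.indicator_mem_flowPolytope hG ha, fun M => if M = L then 1 else 0,
      fun M _ => by positivity, ?_⟩
    simp [ite_smul, Finset.mem_coe.1 hL]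
  · rintro _ ⟨hF, c, hc, rfl⟩ _ ⟨hF', c', hc', rfl⟩ s t hs ht hst
    refine ⟨convex_flowPolytope hF hF' hs ht hst, s • c + t • c', fun L hL =>
      add_nonneg (mul_nonneg hs (hc L hL)) (mul_nonneg ht (hc' L hL)), ?_⟩
    simp [add_smul, mul_smul, Finset.sum_add_distrib, Finset.smul_sum]

theorem exists_subset_eq_polyhedralSimplex_of_isExposed [Finite V] [Nonempty V]
    (hG : G.IsAcyclic) (ha : G.IsConservationist a)
    {S : Set (E → ℝ)} (hS : IsExposed ℝ (polyhedralSimplex K) S) :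
    ∃ K' ⊆ K, S = polyhedralSimplex K' := by
  rw [polyhedralSimplex_eq_convexHull hG ha] at hS
  obtain ⟨t, ht, rfl⟩ := exists_subset_eq_convexHull_of_isExposed hS
  obtain ⟨K', hK', rfl⟩ := Set.subset_image_iff.1 ht
  lift K' to Finset (G.Layering a) using K.finite_toSet.subset hK'
  exact ⟨K', Finset.coe_subset.1 hK', (polyhedralSimplex_eq_convexHull hG ha K').symm⟩

theorem mem_polyhedralSimplex_iff [Fintype G.Route] [Fintype (G.Layering a)] {F : E → ℝ} :
    F ∈ polyhedralSimplex K ↔ F ∈ G.flowPolytope a ∧ ∃ y : G.Layering a → ℝ,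
      0 ≤ y ∧ (∀ L, y L ≠ 0 → L ∈ K) ∧ routeFlow (routeWeight y) = F := by
  refine and_congr_right fun _ => ⟨?_, ?_⟩
  · rintro ⟨c, hc, rfl⟩
    refine ⟨fun L => if L ∈ K then c L else 0, fun L => ?_, by simp +contextual, ?_⟩
    · by_cases hL : L ∈ K <;> simp [hL, hc]
    · simp [routeFlow_routeWeight, ite_smul]
  · rintro ⟨y, hy, hyK, rfl⟩
    refine ⟨y, fun L _ => hy L, ?_⟩
    rw [routeFlow_routeWeight, Finset.sum_subset K.subset_univ]
    intro L _ hL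
    rw [not_imp_comm.1 (hyK L) hL, zero_smul]

namespace Framing

variable {Φ : G.Framing}

theorem exists_layeringSimplex_mem [Finite V] (hG : G.IsAcyclic) (ha : G.IsConservationist a)
    (Φ : G.Framing) {F : E → ℝ} (hF : F ∈ G.flowPolytope a) :
    ∃ K : Finset (G.Layering a), Φ.IsLayeringSimplex K ∧ F ∈ polyhedralSimplex K := by
  have := Route.finite hG
  have := Fintype.ofFinite G.Route
  have := Fintype.ofFinite (G.Layering a)
  obtain ⟨c, hc, hclique, rfl⟩ := (ha.isFlow hF).exists_decomposition hG ha.not_isSink Φ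
  obtain ⟨K, y, hK, -, hy, hyK, rfl⟩ :=
    ((routeFlow_mem_flowPolytope_iff hG ha hc).1 hF).exists_layeringSimplex hc hclique
  exact ⟨K, hK, mem_polyhedralSimplex_iff.2 ⟨hF, y, hy, hyK, rfl⟩⟩

theorem polyhedralSimplex_inter [Finite V] (hG : G.IsAcyclic) (ha : G.IsConservationist a)
    (hK : Φ.IsLayeringSimplex K) (hK' : Φ.IsLayeringSimplex K') :
    polyhedralSimplex K ∩ polyhedralSimplex K' = polyhedralSimplex (K ∩ K') := by
  have := Route.finite hG
  have := Fintype.ofFinite G.Route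
  have := Fintype.ofFinite (G.Layering a)
  ext F
  simp only [Set.mem_inter_iff, mem_polyhedralSimplex_iff, Finset.mem_inter]
  constructor
  · rintro ⟨⟨hF, y, hy, hyK, rfl⟩, -, y', hy', hyK', h⟩
    have hweight : routeWeight y = routeWeight y' := funext fun p => by
      rw [← coefficient_routeFlow hG ha.not_isSink (routeWeight_nonneg hy)
        (hK.clique.mono fun p => mem_routesOf_of_routeWeight_ne_zero hyK), ← h,
        coefficient_routeFlow hG ha.not_isSink (routeWeight_nonneg hy')
        (hK'.clique.mono fun p => mem_routesOf_of_routeWeight_ne_zero hyK')]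
    obtain rfl := hK.eq_of_routeWeight_eq hK' hyK hyK' hy hy' hweight
    exact ⟨hF, y, hy, fun L hL => ⟨hyK L hL, hyK' L hL⟩, rfl⟩
  · rintro ⟨hF, y, hy, hyK, rfl⟩
    exact ⟨⟨hF, y, hy, fun L hL => (hyK L hL).1, rfl⟩, hF, y, hy, fun L hL => (hyK L hL).2, rfl⟩

end Framing

end FlowPolytope

namespace Framing.IsLayeringSimplex

variable {Φ : G.Framing} {K : Finset (G.Layering a)}

variable [Finite V]

theorem linearIndepOn_indicator [Finite E] (hG : G.IsAcyclic) (ha : G.IsConservationist a)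
    (hK : Φ.IsLayeringSimplex K) : LinearIndepOn ℝ Layering.indicator (K : Set (G.Layering a)) := by
  have := Route.finite hG
  have := Fintype.ofFinite G.Route
  have := Fintype.ofFinite (G.Layering a)
  refine linearIndepOn_finset_iff.2 fun c hc L hL => ?_
  have hyK : ∀ M, (if M ∈ K then c M else 0) ≠ 0 → M ∈ K := by simp +contextual
  have hweight := hK.clique.eq_zero_of_routeFlow_eq_zero hG ha.not_isSink
    (fun p => mem_routesOf_of_routeWeight_ne_zero hyK)
    (by simpa [routeFlow_routeWeight, ite_smul] using hc)
  have hmem := hK.coeff_mem hyK (H := ⊥) (fun p => by simp [hweight]) L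
  simpa [hL] using hmem

theorem coeff_integer [Finite E] (hG : G.IsAcyclic) (ha : G.IsConservationist a)
    (hK : Φ.IsLayeringSimplex K) {c : G.Layering a → ℝ}
    (hc : IsIntegerPoint (∑ L ∈ K, c L • L.indicator)) : ∀ L ∈ K, ∃ n : ℤ, c L = n := by
  have := Route.finite hG
  have := Fintype.ofFinite G.Route
  have := Fintype.ofFinite (G.Layering a)
  intro L hL
  have hyK : ∀ M, (if M ∈ K then c M else 0) ≠ 0 → M ∈ K := by simp +contextual
  have hweight := hK.clique.isIntegerPoint_of_routeFlow hG ha.not_isSink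
    (fun p => mem_routesOf_of_routeWeight_ne_zero hyK)
    (by simpa [routeFlow_routeWeight, ite_smul] using hc)
  obtain ⟨n, hn⟩ := hK.coeff_mem hyK (H := (Int.castAddHom ℝ).range)
    (fun p => (hweight p).imp fun _ => Eq.symm) L
  exact ⟨n, by simpa [hL] using hn.symm⟩

variable [Nonempty V] [Fintype E]

theorem isIntegerSimplex (hG : G.IsAcyclic) (ha : G.IsConservationist a)
    (hK : Φ.IsLayeringSimplex K) : IsIntegerSimplex (polyhedralSimplex K) := by
  refine ⟨K.image Layering.indicator, ?_, ?_, ?_⟩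
  · simpa using fun L _ => L.isIntegerPoint_indicator
  · have h := (hK.linearIndepOn_indicator hG ha).id_image.affineIndependent
    rwa [← Finset.coe_image] at h
  · rw [polyhedralSimplex_eq_convexHull hG ha, Finset.coe_image]

theorem isExposed_polyhedralSimplex (hG : G.IsAcyclic) (ha : G.IsConservationist a)
    (hK : Φ.IsLayeringSimplex K) {K' : Finset (G.Layering a)} (h : K' ⊆ K) :
    IsExposed ℝ (polyhedralSimplex K) (polyhedralSimplex K') := by
  rw [polyhedralSimplex_eq_convexHull hG ha, polyhedralSimplex_eq_convexHull hG ha]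
  exact isExposed_convexHull_of_linearIndepOn (hK.linearIndepOn_indicator hG ha).id_image
    (Set.image_mono h)

theorem normalizedVolume_polyhedralSimplex (hG : G.IsAcyclic) (ha : G.IsConservationist a)
    (hK : Φ.IsLayeringSimplex K) (hne : K.Nonempty) :
    normalizedVolume (polyhedralSimplex K) = 1 := by
  rw [polyhedralSimplex_eq_convexHull hG ha]
  exact normalizedVolume_convexHull_image hne (hK.linearIndepOn_indicator hG ha)
    (fun L _ => L.isIntegerPoint_indicator) fun _ => hK.coeff_integer hG ha

end Framing.IsLayeringSimplex

section Triangulation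

variable [Finite V] [Nonempty V] [Fintype E]

theorem isIntegerPolytope_flowPolytope (hG : G.IsAcyclic) (ha : G.IsConservationist a)
    (Φ : G.Framing) : IsIntegerPolytope (G.flowPolytope a) := by
  have := Route.finite hG
  have := Fintype.ofFinite (G.Layering a)
  refine ⟨Finset.univ.image (Layering.indicator (G := G) (a := a)), ?_,
    subset_antisymm (fun F hF => ?_) (convexHull_min ?_ convex_flowPolytope)⟩
  · simpa using fun L : G.Layering a => L.isIntegerPoint_indicator
  · obtain ⟨K, -, hFK⟩ := Φ.exists_layeringSimplex_mem hG ha hF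
    rw [polyhedralSimplex_eq_convexHull hG ha] at hFK
    exact convexHull_mono (by simp [Set.subset_def]) hFK
  · simpa [Set.subset_def] using Layering.indicator_mem_flowPolytope hG ha

theorem isLatticeTriangulation_framingTriangulation (hG : G.IsAcyclic)
    (ha : G.IsConservationist a) (Φ : G.Framing) :
    IsLatticeTriangulation (G.flowPolytope a) (framingTriangulation a Φ) where
  isIntegerPolytope := isIntegerPolytope_flowPolytope hG ha Φ
  finite := by
    have := Route.finite hG
    refine (Set.finite_range fun K : Finset (G.Layering a) => polyhedralSimplex K).subset ?_
    rintro _ ⟨K, -, rfl⟩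
    exact ⟨K, rfl⟩
  isIntegerSimplex := by
    rintro _ ⟨K, hK, rfl⟩
    exact hK.isIntegerSimplex hG ha
  cover := by
    refine subset_antisymm (fun F hF => ?_) (Set.sUnion_subset ?_)
    · obtain ⟨K, hK, hFK⟩ := Φ.exists_layeringSimplex_mem hG ha hF
      exact ⟨_, ⟨K, hK, rfl⟩, hFK⟩
    · rintro _ ⟨K, -, rfl⟩
      exact Set.sep_subset _ _
  face_mem := by
    rintro _ ⟨K, hK, rfl⟩ S hS
    obtain ⟨K', hK', rfl⟩ := exists_subset_eq_polyhedralSimplex_of_isExposed hG ha hS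
    exact ⟨K', hK.mono hK', rfl⟩
  inter_face := by
    rintro _ ⟨K, hK, rfl⟩ _ ⟨K', hK', rfl⟩
    rw [Framing.polyhedralSimplex_inter hG ha hK hK']
    exact ⟨hK.isExposed_polyhedralSimplex hG ha Finset.inter_subset_left,
      hK'.isExposed_polyhedralSimplex hG ha Finset.inter_subset_right⟩

theorem isUnimodularLatticeTriangulation_framingTriangulation (hG : G.IsAcyclic)
    (ha : G.IsConservationist a) (Φ : G.Framing) :
    IsUnimodularLatticeTriangulation (G.flowPolytope a) (framingTriangulation a Φ) := by
  refine ⟨isLatticeTriangulation_framingTriangulation hG ha Φ, ?_⟩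
  rintro _ ⟨K, hK, rfl⟩ hne
  refine hK.normalizedVolume_polyhedralSimplex hG ha ?_
  rw [polyhedralSimplex_eq_convexHull hG ha] at hne
  simpa using hne

end Triangulation

end DirectedMultigraph

end

theorem corollary3p13 {V E : Type*} [Fintype V] [Nonempty V] [Fintype E]
    (G : DirectedMultigraph V E) (hG : G.IsAcyclic)
    (a : V → ℤ) (ha : G.IsConservationist a) (Φ : G.Framing) :
    IsUnimodularLatticeTriangulation (G.flowPolytope a)
        (DirectedMultigraph.framingTriangulation a Φ) ∧
      (∀ K : Finset (G.Layering a), Φ.IsLayeringSimplex K →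
        AffineIndependent ℝ (fun L : K => (L : G.Layering a).indicator) ∧
        DirectedMultigraph.polyhedralSimplex K =
          convexHull ℝ (DirectedMultigraph.Layering.indicator '' (K : Set (G.Layering a)))) ∧
      ∀ K L : Finset (G.Layering a), Φ.IsLayeringSimplex K → Φ.IsLayeringSimplex L →
        DirectedMultigraph.polyhedralSimplex K ∩ DirectedMultigraph.polyhedralSimplex L =
          DirectedMultigraph.polyhedralSimplex (K ∩ L) :=
  ⟨DirectedMultigraph.isUnimodularLatticeTriangulation_framingTriangulation hG ha Φ,
    fun K hK => ⟨(hK.linearIndepOn_indicator hG ha).linearIndependent.affineIndependent,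
      DirectedMultigraph.polyhedralSimplex_eq_convexHull hG ha K⟩,
    fun _ _ hK hL => DirectedMultigraph.Framing.polyhedralSimplex_inter hG ha hK hL⟩
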